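/- Let $0<q<1$, $\mathbb{A}=\{z\in\mathbb{C}:q<|z|<1\}$, and let $B=B_1\cup B_q$ be its boundary, where $B_1=\{|z|=1\}$ and $B_q=\{|z|=q\}$. Let $\mu$ be the measure on $B$ that restricts on each of $B_1$, $B_q$ to the multiple of arclength with total mass $2\pi$, and write $L^p(B)=L^p(B,\mu)$. For $\alpha\in[0,1)$ let $H^2_\alpha\subset L^2(B)$ be the closed subspace of boundary functions of those (multivalued) analytic functions $F$ on $\mathbb{A}$ (i.e. analytic functions on the universal cover of $\mathbb{A}$, in coordinates $z=re^{it}$, $q<r<1$, $t\in\mathbb{R}$) that satisfy $$F(r,t+2\pi)=e^{2\pi i\alpha}F(r,t)\quad\text{and}\quad \sup_{q<r<1}\int_{-\pi}^{\pi}|F(r,t)|^2\,dt<\infty,$$ where $F$ is made single-valued on $B$ by the branch $-\pi<t\le\pi$, and boundary functions are limits in $L^2$ as $r\to1$ and $r\to q$. For a real-valued $\phi\in L^\infty(B)$ let $T^\alpha_\phi g=P_\alpha(\phi g)$, $g\in H^2_\alpha$, be the Toeplitz operator, where $P_\alpha$ is the orthogonal projection of $L^2(B)$ onto $H^2_\alpha$.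 Call $\lambda\in\mathbb{C}$ an eigenvalue of $\phi$ relative to $A(\mathbb{A})$ (the algebra of functions continuous on $\overline{\mathbb{A}}$ and analytic in $\mathbb{A}$) if there are $\alpha\in[0,1)$ and a nonzero $g\in H^2_\alpha$ with $T^\alpha_\phi g=\lambda g$. Then for every real-valued $\phi\in L^\infty(B)$ the set of eigenvalues of $\phi$ relative to $A(\mathbb{A})$ is a subset of $\mathbb{R}$ that is either empty, or a single point, or an interval with real endpoints $m<M$ (each endpoint may or may not belong to it). -/

import Mathlib

open MeasureTheory Set Filter Topology
open scoped ENNReal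

noncomputable section

namespace AnnulusToeplitz

/-- Lebesgue measure `dt` on one period `(-π, π]` of the angular variable. -/
def angle : Measure ℝ := volume.restrict (Ioc (-Real.pi) Real.pi)

/-- The parametrization `t ↦ ρ e^{it}` of the circle of radius `ρ` about `0`. -/
def circ (ρ t : ℝ) : ℂ := (ρ : ℂ) * Complex.exp ((t : ℂ) * Complex.I)

/-- Arclength on the circle `|z| = ρ`, rescaled to have total mass `2π` (the image of `dt`). -/
def circleMeasure (ρ : ℝ) : Measure ℂ := angle.map (circ ρ)

/-- The measure `μ = μ₁ + μ_q` carried by the boundary `B = {|z| = 1} ∪ {|z| = q}` of the annulus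
`q < |z| < 1`. The spaces `L²(B)` and `L^∞(B)` are the `Lp` spaces of this measure. -/
def boundaryMeasure (q : ℝ) : Measure ℂ := circleMeasure 1 + circleMeasure q

/-- The universal covering surface of the annulus `q < |z| < 1`, with covering map `exp`.
In the polar coordinates `(r, t)`, `z = r e^{it}`, the point `w` is `log r + i t`. -/
def cover (q : ℝ) : Set ℂ := {w : ℂ | Real.log q < w.re ∧ w.re < 0}

/-- The restriction `t ↦ F (s + i t)` of a function on the covering surface to the line over the
circle of radius `e^s`. -/
def slice (F : ℂ → ℂ) (s t : ℝ) : ℂ := F ((s : ℂ) + (t : ℂ) * Complex.I)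

/-- `F` is an analytic, modulus automorphic function of index `α` on the covering surface
(`F (r, t + 2π) = e^{2πiα} F (r, t)`), whose `L²` means over the circles of radius `r`,
`q < r < 1`, are bounded. (As `|F|` is `2π`-periodic in `t`, the means may be taken over any period;
the zero function has every index.) -/
structure IsHardy (q α : ℝ) (F : ℂ → ℂ) : Prop where
  analytic : DifferentiableOn ℂ F (cover q)
  index : ∀ w ∈ cover q, F (w + 2 * Real.pi * Complex.I) =
    Complex.exp (2 * Real.pi * Complex.I * α) * F w
  bounded_means : ∃ C : NNReal, ∀ s ∈ Ioo (Real.log q) 0, eLpNorm (slice F s) 2 angle ≤ C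

/-- `g`, a function on the boundary `B`, is the boundary function of `F`, in the sense of `L²` limits
over both boundary circles. A multivalued function on the annulus is made single valued on `B` by its
branch with `-π < arg z ≤ π`. -/
structure HasBoundaryValue (q : ℝ) (F g : ℂ → ℂ) : Prop where
  outer_circle :
    Tendsto (fun s : ℝ => eLpNorm (slice F s - g ∘ circ 1) 2 angle) (𝓝[<] 0) (𝓝 0)
  inner_circle :
    Tendsto (fun s : ℝ => eLpNorm (slice F s - g ∘ circ q) 2 angle) (𝓝[>] (Real.log q)) (𝓝 0)

theorem measurable_circ (ρ : ℝ) : Measurable (circ ρ) := by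
  unfold circ; fun_prop

theorem quasi_one (q : ℝ) :
    Measure.QuasiMeasurePreserving (circ 1) angle (boundaryMeasure q) :=
  ⟨measurable_circ 1, (Measure.le_add_right le_rfl).absolutelyContinuous⟩

theorem quasi_q (q : ℝ) :
    Measure.QuasiMeasurePreserving (circ q) angle (boundaryMeasure q) :=
  ⟨measurable_circ q, (Measure.le_add_left le_rfl).absolutelyContinuous⟩

theorem continuous_slice {q : ℝ} {F : ℂ → ℂ} (h : DifferentiableOn ℂ F (cover q)) {s : ℝ}
    (hs : s ∈ Ioo (Real.log q) 0) : Continuous (slice F s) := by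
  unfold slice
  refine h.continuousOn.comp_continuous (by fun_prop) (fun t => ?_)
  simpa [cover] using hs

theorem IsHardy.add {q α : ℝ} {F G : ℂ → ℂ} (hF : IsHardy q α F) (hG : IsHardy q α G) :
    IsHardy q α (F + G) where
  analytic := hF.analytic.add hG.analytic
  index w hw := by simp only [Pi.add_apply, hF.index w hw, hG.index w hw]; ring
  bounded_means := by
    obtain ⟨C, hC⟩ := hF.bounded_means
    obtain ⟨D, hD⟩ := hG.bounded_means
    refine ⟨C + D, fun s hs => ?_⟩
    have := eLpNorm_add_le (μ := angle) (p := 2)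
      (continuous_slice hF.analytic hs).aestronglyMeasurable
      (continuous_slice hG.analytic hs).aestronglyMeasurable (by norm_num)
    refine this.trans ?_
    push_cast
    exact add_le_add (hC s hs) (hD s hs)

theorem IsHardy.smul {q α : ℝ} {F : ℂ → ℂ} (hF : IsHardy q α F) (c : ℂ) :
    IsHardy q α (c • F) where
  analytic := hF.analytic.const_smul c
  index w hw := by simp only [Pi.smul_apply, hF.index w hw, smul_eq_mul]; ring
  bounded_means := by
    obtain ⟨C, hC⟩ := hF.bounded_means
    refine ⟨‖c‖₊ * C, fun s hs => ?_⟩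
    have : slice (c • F) s = c • slice F s := rfl
    rw [this, eLpNorm_const_smul]
    push_cast
    exact mul_le_mul_right (hC s hs) _

theorem tendsto_add_aux {l : Filter ℝ} {F G : ℂ → ℂ} {a b : ℝ → ℂ}
    (hmF : ∀ᶠ s in l, AEStronglyMeasurable (slice F s) angle)
    (hmG : ∀ᶠ s in l, AEStronglyMeasurable (slice G s) angle)
    (ha : AEStronglyMeasurable a angle) (hb : AEStronglyMeasurable b angle)
    (h1 : Tendsto (fun s => eLpNorm (slice F s - a) 2 angle) l (𝓝 0))
    (h2 : Tendsto (fun s => eLpNorm (slice G s - b) 2 angle) l (𝓝 0)) :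
    Tendsto (fun s => eLpNorm (slice (F + G) s - (a + b)) 2 angle) l (𝓝 0) := by
  have h := h1.add h2
  rw [add_zero] at h
  refine tendsto_of_tendsto_of_tendsto_of_le_of_le' tendsto_const_nhds h
    (Eventually.of_forall fun _ => zero_le) ?_
  filter_upwards [hmF, hmG] with s hs1 hs2
  have : slice (F + G) s - (a + b) = (slice F s - a) + (slice G s - b) := by
    funext t; simp only [slice, Pi.add_apply, Pi.sub_apply]; ring
  rw [this]
  exact eLpNorm_add_le (hs1.sub ha) (hs2.sub hb) (by norm_num)

theorem eventually_outer {q : ℝ} (hq : q ∈ Ioo (0 : ℝ) 1) {F : ℂ → ℂ}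
    (h : DifferentiableOn ℂ F (cover q)) :
    ∀ᶠ s in 𝓝[<] (0 : ℝ), AEStronglyMeasurable (slice F s) angle := by
  filter_upwards [Ioo_mem_nhdsLT (Real.log_neg hq.1 hq.2)] with s hs
  exact (continuous_slice h hs).aestronglyMeasurable

theorem eventually_inner {q : ℝ} (hq : q ∈ Ioo (0 : ℝ) 1) {F : ℂ → ℂ}
    (h : DifferentiableOn ℂ F (cover q)) :
    ∀ᶠ s in 𝓝[>] (Real.log q), AEStronglyMeasurable (slice F s) angle := by
  filter_upwards [Ioo_mem_nhdsGT (Real.log_neg hq.1 hq.2)] with s hs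
  exact (continuous_slice h hs).aestronglyMeasurable

theorem HasBoundaryValue.congr {q : ℝ} {F g h : ℂ → ℂ} (hF : HasBoundaryValue q F g)
    (hgh : g =ᵐ[boundaryMeasure q] h) : HasBoundaryValue q F h where
  outer_circle := hF.outer_circle.congr fun s => eLpNorm_congr_ae <| by
    filter_upwards [(quasi_one q).ae hgh] with t ht
    simp [ht]
  inner_circle := hF.inner_circle.congr fun s => eLpNorm_congr_ae <| by
    filter_upwards [(quasi_q q).ae hgh] with t ht
    simp [ht]

theorem tendsto_smul_aux {l : Filter ℝ} {F : ℂ → ℂ} {a : ℝ → ℂ} (c : ℂ)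
    (h : Tendsto (fun s => eLpNorm (slice F s - a) 2 angle) l (𝓝 0)) :
    Tendsto (fun s => eLpNorm (slice (c • F) s - c • a) 2 angle) l (𝓝 0) := by
  have key : ∀ s, eLpNorm (slice (c • F) s - c • a) 2 angle =
      ‖c‖ₑ * eLpNorm (slice F s - a) 2 angle := fun s => by
    rw [← eLpNorm_const_smul, smul_sub]; rfl
  simp only [key]
  simpa using ENNReal.Tendsto.const_mul (a := ‖c‖ₑ) h (Or.inr enorm_ne_top)

/-- The Hardy space `H²_α` of the annulus `q < |z| < 1` as a subspace of `L²(B)`: the boundary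
functions of the analytic, modulus automorphic functions of index `α` with bounded `L²` means. -/
def hardySpace {q : ℝ} (hq : q ∈ Ioo (0 : ℝ) 1) (α : ℝ) :
    Submodule ℂ (Lp ℂ 2 (boundaryMeasure q)) where
  carrier := {g | ∃ F, IsHardy q α F ∧ HasBoundaryValue q F g}
  zero_mem' := by
    have h2 : ∀ s : ℝ, slice 0 s = 0 := fun s => by funext t; simp [slice]
    refine ⟨0, ⟨differentiableOn_const 0, fun w _ => by simp, 0, fun s _ => by simp [h2]⟩,
      HasBoundaryValue.congr (g := 0) ⟨?_, ?_⟩ (Lp.coeFn_zero ℂ 2 (boundaryMeasure q)).symm⟩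
    · simp [h2]
    · simp [h2]
  add_mem' := by
    rintro g h ⟨F, hF, hFg⟩ ⟨G, hG, hGh⟩
    refine ⟨F + G, hF.add hG,
      HasBoundaryValue.congr (g := (g : ℂ → ℂ) + h) ⟨?_, ?_⟩ (Lp.coeFn_add g h).symm⟩
    · exact tendsto_add_aux (eventually_outer hq hF.analytic) (eventually_outer hq hG.analytic)
        ((Lp.aestronglyMeasurable g).comp_quasiMeasurePreserving (quasi_one q))
        ((Lp.aestronglyMeasurable h).comp_quasiMeasurePreserving (quasi_one q))
        hFg.outer_circle hGh.outer_circle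
    · exact tendsto_add_aux (eventually_inner hq hF.analytic) (eventually_inner hq hG.analytic)
        ((Lp.aestronglyMeasurable g).comp_quasiMeasurePreserving (quasi_q q))
        ((Lp.aestronglyMeasurable h).comp_quasiMeasurePreserving (quasi_q q))
        hFg.inner_circle hGh.inner_circle
  smul_mem' := by
    rintro c g ⟨F, hF, hFg⟩
    exact ⟨c • F, hF.smul c, HasBoundaryValue.congr (g := c • (g : ℂ → ℂ))
      ⟨tendsto_smul_aux c hFg.outer_circle, tendsto_smul_aux c hFg.inner_circle⟩
      (Lp.coeFn_smul c g).symm⟩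

/-- The Toeplitz operator `T_φ^α g = P_α (φ g)` on `H²_α`, with real symbol `φ ∈ L^∞(B)`, where `P_α`
is the orthogonal projection of `L²(B)` onto `H²_α`. (`H²_α` is a closed subspace; its closure is
written here, which does not change it, because Mathlib projects onto complete subspaces.) -/
def toeplitz {q : ℝ} (hq : q ∈ Ioo (0 : ℝ) 1) (α : ℝ) (φ : Lp ℝ ∞ (boundaryMeasure q))
    (g : hardySpace hq α) : Lp ℂ 2 (boundaryMeasure q) :=
  (hardySpace hq α).topologicalClosure.starProjection
    (φ • (g : Lp ℂ 2 (boundaryMeasure q)) : Lp ℂ 2 (boundaryMeasure q))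

/-- The set of eigenvalues of `φ` relative to the annulus algebra: those `c` for which there are an
`α ∈ [0, 1)` and a nonzero `g ∈ H²_α` with `T_φ^α g = c g`. -/
def relativeEigenvalues {q : ℝ} (hq : q ∈ Ioo (0 : ℝ) 1) (φ : Lp ℝ ∞ (boundaryMeasure q)) : Set ℂ :=
  {c | ∃ α ∈ Ico (0 : ℝ) 1, ∃ g : hardySpace hq α, g ≠ 0 ∧
    toeplitz hq α φ g = c • (g : Lp ℂ 2 (boundaryMeasure q))}

end AnnulusToeplitz

end

noncomputable section

namespace AnnulusToeplitz

/-! The equation T g = c g says that (φ - c) g is orthogonal to H²_α (`toeplitz_eq_smul_iff`).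
Testing against g itself makes c a weighted mean of φ, so c is real and bounded by the symbol
(`eigenvalue_real`). It remains to see that the real eigenvalues form an order-connected set.

Testing against zⁿ g for every integer n shows that, for a real eigenvalue l, (φ - l)|g|² is a
constant d on B₁ and -d on B_q (`exists_const_of_eigen`). If d ≠ 0, then φ - l has one strict sign
on B₁ and the opposite one on B_q. Let l₁ < l < l₂ with l₁, l₂ eigenvalues, and compare the signs of
their constants. If the constants are nonzero with the same sign, φ - l is bounded away from 0 with
opposite signs on the two circles. Every other combination contradicts l₁ < l₂, or makes a nonzero
Hardy function vanish on a circle, or makes a product of two of them vanish on B₁; boundary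
uniqueness excludes the last two (`eq_zero_or_eq_zero_of_mul_ae_eq_zero`).

Conversely, such a separation makes l an eigenvalue (`mem_relativeEigenvalues_of_separated`). Put w
= |φ - l|. Writing g = z^α f and h = z^α k with f, k in H²_0, the orthogonality becomes ∫_{B₁} w f
k̄ = q^{2α} ∫_{B_q} w f k̄. A compactness argument gives f ≠ 0 and 0 < μ < 1 with ∫_{B₁} w f k̄ = μ
∫_B w f k̄ for all k (`exists_weighted_eigenvector`), and α is then chosen so that q^{2α} = μ/(1 -
μ). The freedom in α is what produces whole intervals of eigenvalues.

Throughout, H²_α is handled through Fourier coefficients: g belongs to it exactly when the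
coefficient of frequency k + α on B_q is q^{k+α} times the one on B₁ (`mem_hardySpace_iff`). -/

instance : IsFiniteMeasure angle := by unfold angle; infer_instance

theorem ae_angle_mem : ∀ᵐ t ∂angle, t ∈ Ioc (-Real.pi) Real.pi :=
  ae_restrict_mem measurableSet_Ioc

/-! ### Fourier analysis over one period, with shifted frequencies -/

/-- The character `t ↦ e^{ibt}`. -/
def char (b t : ℝ) : ℂ := Complex.exp ((b * t : ℝ) * Complex.I)

theorem continuous_char (b : ℝ) : Continuous (char b) := by unfold char; fun_prop

@[simp] theorem norm_char (b t : ℝ) : ‖char b t‖ = 1 := Complex.norm_exp_ofReal_mul_I _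

theorem char_add (a b t : ℝ) : char (a + b) t = char a t * char b t := by
  unfold char; rw [← Complex.exp_add]; push_cast; ring_nf

@[simp] theorem char_zero (t : ℝ) : char 0 t = 1 := by simp [char]

theorem char_neg (b t : ℝ) : char (-b) t = (starRingEnd ℂ) (char b t) := by
  unfold char; rw [← Complex.exp_conj]; simp

theorem char_mul_neg (b t : ℝ) : char b t * char (-b) t = 1 := by
  rw [← char_add]; simp

/-- The Fourier coefficient of frequency `b` over one period. -/
def coef (b : ℝ) (f : ℝ → ℂ) : ℂ := ∫ t, f t * char (-b) t ∂angle

theorem integrable_mul_char {f : ℝ → ℂ} (hf : Integrable f angle) (b : ℝ) :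
    Integrable (fun t => f t * char b t) angle :=
  hf.mul_bdd (c := 1) (continuous_char b).aestronglyMeasurable (by simp)

theorem coef_mul_char (a b : ℝ) (f : ℝ → ℂ) :
    coef (b + a) (fun t => f t * char a t) = coef b f := by
  unfold coef
  congr 1; funext t
  rw [neg_add, char_add]
  linear_combination f t * char (-b) t * char_mul_neg a t

theorem coef_congr {f g : ℝ → ℂ} (h : f =ᵐ[angle] g) (b : ℝ) : coef b f = coef b g :=
  integral_congr_ae (by filter_upwards [h] with t ht; rw [ht])

theorem coef_const_mul (c : ℂ) (b : ℝ) (f : ℝ → ℂ) : coef b (fun t => c * f t) = c * coef b f := by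
  unfold coef; simp_rw [mul_assoc]; exact integral_const_mul _ _

theorem coef_sub {f g : ℝ → ℂ} (hf : Integrable f angle) (hg : Integrable g angle) (b : ℝ) :
    coef b (fun t => f t - g t) = coef b f - coef b g := by
  unfold coef; simp_rw [sub_mul]
  exact integral_sub (integrable_mul_char hf _) (integrable_mul_char hg _)

theorem norm_coef_le (f : ℝ → ℂ) (b : ℝ) : ‖coef b f‖ ≤ ∫ t, ‖f t‖ ∂angle := by
  refine (norm_integral_le_integral_norm _).trans_eq ?_
  simp

theorem coef_char_ne {k n : ℤ} (h : k ≠ n) (a : ℝ) : coef (k + a) (char (n + a)) = 0 := by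
  have h1 : ∀ t, char (n + a) t * char (-(k + a)) t
      = Complex.exp (((n - k : ℤ) * Complex.I : ℂ) * t) := fun t => by
    rw [← char_add]; unfold char; push_cast; ring_nf
  unfold coef angle
  simp_rw [h1]
  have h0 : ((n - k : ℤ) : ℂ) ≠ 0 := by exact_mod_cast sub_ne_zero.2 h.symm
  rw [← intervalIntegral.integral_of_le (by linarith [Real.pi_pos]),
    integral_exp_mul_complex (by simpa [Complex.I_ne_zero] using h0)]
  have : Complex.exp (((n - k : ℤ) * Complex.I : ℂ) * (Real.pi : ℝ))
      = Complex.exp (((n - k : ℤ) * Complex.I : ℂ) * ((-Real.pi : ℝ) : ℂ)) := by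
    rw [Complex.exp_eq_exp_iff_exists_int]
    exact ⟨n - k, by push_cast; ring⟩
  rw [this]; simp

theorem coef_char_self (b : ℝ) : coef b (char b) = 2 * Real.pi := by
  unfold coef
  simp_rw [char_mul_neg]
  simp [angle, Measure.real, ← two_mul, Real.pi_pos.le]

instance : Fact (0 < 2 * Real.pi) := ⟨Real.two_pi_pos⟩

/-- Trigonometric polynomials are dense in the continuous functions on the circle, so f integrates
to zero against all of these, in particular against the smooth bumps supported inside the open
period. This works for f merely in L¹, which is needed for products such as (φ - l)|g|². -/
theorem ae_eq_zero_of_coef_int_eq_zero {f : ℝ → ℂ} (hf : Integrable f angle)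
    (h : ∀ k : ℤ, coef k f = 0) : f =ᵐ[angle] 0 := by
  have key : ∀ g : C(AddCircle (2 * Real.pi), ℂ), ∫ t, g (t : AddCircle (2 * Real.pi)) * f t ∂angle = 0 := by
    have hint : ∀ g : C(AddCircle (2 * Real.pi), ℂ),
        Integrable (fun t : ℝ => g (t : AddCircle (2 * Real.pi)) * f t) angle := fun g =>
      hf.bdd_mul (c := ‖g‖) (g.continuous.comp (AddCircle.continuous_mk' _)).aestronglyMeasurable
        (Eventually.of_forall fun t => g.norm_coe_le_norm _)
    let Λ : C(AddCircle (2 * Real.pi), ℂ) →ₗ[ℂ] ℂ :=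
      { toFun := fun g => ∫ t, g (t : AddCircle (2 * Real.pi)) * f t ∂angle
        map_add' := fun g₁ g₂ => by
          simp only [ContinuousMap.add_apply, add_mul]; exact integral_add (hint g₁) (hint g₂)
        map_smul' := fun c g => by
          simp only [ContinuousMap.smul_apply, smul_eq_mul, mul_assoc, RingHom.id_apply]
          exact integral_const_mul _ _ }
    let Λc := Λ.mkContinuous (∫ t, ‖f t‖ ∂angle) (fun g => by
      refine (norm_integral_le_integral_norm _).trans ?_
      rw [mul_comm (∫ t, ‖f t‖ ∂angle), ← integral_const_mul]
      refine integral_mono (hint g).norm (hf.norm.const_mul _) (fun t => ?_)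
      simp only [norm_mul]
      gcongr
      exact g.norm_coe_le_norm _)
    have hΛ : ∀ g, Λc g = 0 := by
      have hk : (Submodule.span ℂ (range <| @fourier (2 * Real.pi))).topologicalClosure
          ≤ LinearMap.ker (Λc : _ →ₗ[ℂ] ℂ) := by
        refine Submodule.topologicalClosure_minimal _ (Submodule.span_le.2 ?_) Λc.isClosed_ker
        rintro _ ⟨n, rfl⟩
        show ∫ t, fourier n (t : AddCircle (2 * Real.pi)) * f t ∂angle = 0
        rw [← h (-n)]
        unfold coef
        congr 1; funext t
        rw [mul_comm, fourier_coe_apply]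
        congr 1
        unfold char
        congr 1
        have := Real.pi_ne_zero
        push_cast
        field_simp
      rw [span_fourier_closure_eq_top] at hk
      exact fun g => hk (Submodule.mem_top (x := g))
    exact hΛ
  have hU : ∀ᵐ t ∂(volume : Measure ℝ), t ∈ Ioo (-Real.pi) Real.pi → f t = 0 := by
    have hf' : IntegrableOn f (Ioc (-Real.pi) Real.pi) := hf
    refine isOpen_Ioo.ae_eq_zero_of_integral_contDiff_smul_eq_zero
      (hf'.mono_set Ioo_subset_Ioc_self).locallyIntegrableOn fun g hg hgc hgs => ?_
    have h0 : g (-Real.pi) = 0 := by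
      by_contra hne
      exact absurd (hgs (subset_tsupport _ hne)) (by simp)
    have h1 : g (-Real.pi + 2 * Real.pi) = 0 := by
      by_contra hne
      have := hgs (subset_tsupport _ hne)
      rw [mem_Ioo] at this; linarith
    -- The bump vanishes at both ends of the period, so its periodic extension is continuous.
    let G : C(AddCircle (2 * Real.pi), ℂ) :=
      ⟨AddCircle.liftIco (2 * Real.pi) (-Real.pi) (fun x => (g x : ℂ)),
        AddCircle.liftIco_continuous (by simp [h0, h1])
          (Complex.continuous_ofReal.comp hg.continuous).continuousOn⟩
    have hG := key G
    rw [← setIntegral_eq_integral_of_forall_compl_eq_zero (s := Ioo (-Real.pi) Real.pi)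
      (fun x hx => by
        have : g x = 0 := by
          by_contra hne; exact hx (hgs (subset_tsupport _ hne))
        simp [this]), ← hG]
    unfold angle
    rw [integral_Ioc_eq_integral_Ioo]
    refine setIntegral_congr_fun measurableSet_Ioo fun t ht => ?_
    have : G (t : AddCircle (2 * Real.pi)) = (g t : ℂ) := by
      refine AddCircle.liftIco_coe_apply (f := fun x => (g x : ℂ)) ⟨ht.1.le, ?_⟩
      have := ht.2; linarith
    simp only [this, Complex.real_smul]
  have hne : ∀ᵐ t ∂(volume : Measure ℝ), t ≠ Real.pi := by simp [ae_iff]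
  unfold angle
  filter_upwards [ae_restrict_of_ae hU, ae_restrict_of_ae hne, ae_restrict_mem measurableSet_Ioc]
    with t h1 h2 h3
  exact h1 ⟨h3.1, lt_of_le_of_ne h3.2 h2⟩

theorem ae_eq_zero_of_coef_eq_zero {f : ℝ → ℂ} (hf : Integrable f angle) (a : ℝ)
    (h : ∀ k : ℤ, coef (k + a) f = 0) : f =ᵐ[angle] 0 := by
  have := ae_eq_zero_of_coef_int_eq_zero (integrable_mul_char hf (-a)) fun k => by
    have := coef_mul_char (-a) (k + a) f
    rw [add_neg_cancel_right] at this
    rw [this, h]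
  filter_upwards [this] with t ht
  have h1 : char (-a) t ≠ 0 := fun h0 => by simpa [h0] using norm_char (-a) t
  simpa [h1] using ht

theorem coef_int_eq_fourierCoeffOn (f : ℝ → ℂ) (n : ℤ) :
    coef n f = (2 * Real.pi) * fourierCoeffOn (neg_lt_self Real.pi_pos) f n := by
  rw [fourierCoeffOn_eq_integral, intervalIntegral.integral_of_le (by linarith [Real.pi_pos])]
  have hπ := Real.pi_ne_zero
  have h2 : Real.pi - -Real.pi = 2 * Real.pi := by ring
  rw [Complex.real_smul, ← mul_assoc]
  have : (2 * Real.pi : ℂ) * ((1 / (Real.pi - -Real.pi) : ℝ) : ℂ) = 1 := by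
    rw [h2]; push_cast; field_simp
  rw [this, one_mul]
  unfold coef angle
  congr 1; funext t
  rw [smul_eq_mul, mul_comm, fourier_coe_apply, h2]
  congr 1
  unfold char
  congr 1
  push_cast
  field_simp

/-- Parseval for the integer frequencies, applied to f times the unimodular function e^{-iat}. -/
theorem hasSum_sq_coef {f : ℝ → ℂ} (hf : MemLp f 2 angle) (a : ℝ) :
    HasSum (fun k : ℤ => ‖coef (k + a) f‖ ^ 2) (2 * Real.pi * ∫ t, ‖f t‖ ^ 2 ∂angle) := by
  have hf' : MemLp (fun t => f t * char (-a) t) 2 angle :=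
    hf.of_le (hf.1.mul (continuous_char _).aestronglyMeasurable) (by simp)
  have h1 := hasSum_sq_fourierCoeffOn (neg_lt_self Real.pi_pos) hf'
  have h2 := h1.mul_left ((2 * Real.pi) ^ 2)
  have e1 : (fun k : ℤ => ‖coef (k + a) f‖ ^ 2) = fun i => (2 * Real.pi) ^ 2 *
      ‖fourierCoeffOn (neg_lt_self Real.pi_pos) (fun t => f t * char (-a) t) i‖ ^ 2 := by
    funext k
    have := coef_mul_char (-a) (k + a) f
    rw [add_neg_cancel_right] at this
    rw [← this, coef_int_eq_fourierCoeffOn, norm_mul, mul_pow]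
    congr 2
    have : ((2 : ℂ) * Real.pi) = ((2 * Real.pi : ℝ) : ℂ) := by push_cast; rfl
    rw [this, Complex.norm_real, Real.norm_of_nonneg Real.two_pi_pos.le]
  have e2 : (2 * Real.pi * ∫ t, ‖f t‖ ^ 2 ∂angle) = (2 * Real.pi) ^ 2 * (Real.pi - -Real.pi)⁻¹ •
      ∫ x in -Real.pi..Real.pi, ‖f x * char (-a) x‖ ^ 2 := by
    rw [intervalIntegral.integral_of_le (by linarith [Real.pi_pos])]
    simp only [norm_mul, norm_char, mul_one, smul_eq_mul, angle]
    have hπ := Real.pi_ne_zero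
    have h2 : Real.pi - -Real.pi = 2 * Real.pi := by ring
    rw [h2]
    field_simp
  rw [e1, e2]
  exact h2

theorem eLpNorm_two_sq {α E : Type*} [MeasurableSpace α] [NormedAddCommGroup E] {μ : Measure α}
    {f : α → E} (hf : MemLp f 2 μ) :
    eLpNorm f 2 μ = ENNReal.ofReal (Real.sqrt (∫ t, ‖f t‖ ^ 2 ∂μ)) := by
  rw [hf.eLpNorm_eq_integral_rpow_norm (by norm_num) (by norm_num)]
  simp [Real.sqrt_eq_rpow]

theorem eLpNorm_two_eq_sqrt_tsum {f : ℝ → ℂ} (hf : MemLp f 2 angle) (a : ℝ) :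
    eLpNorm f 2 angle =
      ENNReal.ofReal (Real.sqrt ((2 * Real.pi)⁻¹ * ∑' k : ℤ, ‖coef (k + a) f‖ ^ 2)) := by
  rw [eLpNorm_two_sq hf, (hasSum_sq_coef hf a).tsum_eq]
  have hπ := Real.pi_ne_zero
  congr 2
  field_simp

theorem tendsto_coef {ι : Type*} {l : Filter ι} {f : ι → ℝ → ℂ} {g : ℝ → ℂ}
    (hf : ∀ᶠ i in l, Integrable (f i) angle) (hg : Integrable g angle)
    (h : Tendsto (fun i => eLpNorm (f i - g) 1 angle) l (𝓝 0)) (b : ℝ) :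
    Tendsto (fun i => coef b (f i)) l (𝓝 (coef b g)) := by
  rw [tendsto_iff_norm_sub_tendsto_zero]
  have h' : Tendsto (fun i => (eLpNorm (f i - g) 1 angle).toReal) l (𝓝 0) := by
    simpa [Function.comp_def] using (ENNReal.tendsto_toReal (by simp)).comp h
  refine squeeze_zero' (Eventually.of_forall fun _ => norm_nonneg _) ?_ h'
  filter_upwards [hf] with i hi
  rw [← coef_sub hi hg]
  refine (norm_coef_le _ _).trans_eq ?_
  change ∫ t, ‖(f i - g) t‖ ∂angle = _
  rw [integral_norm_eq_lintegral_enorm (hi.sub hg).1, eLpNorm_one_eq_lintegral_enorm]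

theorem tendsto_coef_of_L2 {ι : Type*} {l : Filter ι} {f : ι → ℝ → ℂ} {g : ℝ → ℂ}
    (hf : ∀ᶠ i in l, MemLp (f i) 2 angle) (hg : MemLp g 2 angle)
    (h : Tendsto (fun i => eLpNorm (f i - g) 2 angle) l (𝓝 0)) (b : ℝ) :
    Tendsto (fun i => coef b (f i)) l (𝓝 (coef b g)) := by
  refine tendsto_coef (hf.mono fun i hi => hi.integrable (by norm_num))
    (hg.integrable (by norm_num)) ?_ b
  have h2 := ENNReal.Tendsto.mul_const (b := angle univ ^ (1 / (1 : ℝ≥0∞).toReal - 1 / (2 : ℝ≥0∞).toReal)) h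
    (Or.inr (ENNReal.rpow_ne_top_of_nonneg (by norm_num) (measure_ne_top _ _)))
  rw [zero_mul] at h2
  refine tendsto_of_tendsto_of_tendsto_of_le_of_le' tendsto_const_nhds h2
    (Eventually.of_forall fun _ => zero_le) ?_
  filter_upwards [hf] with i hi
  exact eLpNorm_le_eLpNorm_mul_rpow_measure_univ (by norm_num) (hi.sub hg).1

/-! ### The measure on the two boundary circles -/

theorem norm_circ {ρ : ℝ} (hρ : 0 ≤ ρ) (t : ℝ) : ‖circ ρ t‖ = ρ := by
  simp [circ, Complex.norm_exp_ofReal_mul_I, abs_of_nonneg hρ]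

theorem arg_circ {ρ t : ℝ} (hρ : 0 < ρ) (ht : t ∈ Ioc (-Real.pi) Real.pi) : (circ ρ t).arg = t := by
  unfold circ
  rw [Complex.exp_mul_I]
  exact Complex.arg_mul_cos_add_sin_mul_I hρ ht

/-- No measurability of P is assumed. The exceptional null set of angles is enlarged to a measurable
N and carried to the circle by the argument, a measurable inverse of the parametrization on (-π, π].
-/
theorem ae_circleMeasure_iff {ρ : ℝ} (hρ : 0 < ρ) {P : ℂ → Prop} :
    (∀ᵐ z ∂circleMeasure ρ, P z) ↔ ∀ᵐ t ∂angle, P (circ ρ t) := by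
  refine ⟨fun h => ae_of_ae_map (measurable_circ ρ).aemeasurable h, fun h => ?_⟩
  obtain ⟨N, hN, hNm, hN0⟩ := exists_measurable_superset_of_null (ae_iff.1 h)
  have hS : MeasurableSet {z : ℂ | ‖z‖ = ρ → z.arg ∉ N} := by
    have : {z : ℂ | ‖z‖ = ρ → z.arg ∉ N} = {z : ℂ | ‖z‖ = ρ}ᶜ ∪ (Complex.arg ⁻¹' N)ᶜ := by
      ext z; simp [imp_iff_not_or]
    rw [this]
    exact ((measurableSet_eq_fun measurable_norm measurable_const).compl).union
      (Complex.measurable_arg hNm).compl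
  have h1 : ∀ᵐ z ∂circleMeasure ρ, ‖z‖ = ρ → z.arg ∉ N := by
    refine (ae_map_iff (measurable_circ ρ).aemeasurable hS).2 ?_
    filter_upwards [measure_eq_zero_iff_ae_notMem.1 hN0, ae_angle_mem] with t ht ht' _
    rwa [arg_circ hρ ht']
  have h2 : ∀ᵐ z ∂circleMeasure ρ, ‖z‖ = ρ :=
    (ae_map_iff (measurable_circ ρ).aemeasurable
      (measurableSet_eq_fun measurable_norm measurable_const)).2
      (Eventually.of_forall fun t => norm_circ hρ.le t)
  filter_upwards [h1, h2] with z hz hz'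
  by_contra hP
  refine hz hz' (hN ?_)
  have : circ ρ z.arg = z := by rw [← hz']; exact Complex.norm_mul_exp_arg_mul_I z
  simpa [this] using hP

theorem ae_boundary_iff {q : ℝ} (hq : q ∈ Ioo (0 : ℝ) 1) {P : ℂ → Prop} :
    (∀ᵐ z ∂boundaryMeasure q, P z) ↔
      (∀ᵐ t ∂angle, P (circ 1 t)) ∧ ∀ᵐ t ∂angle, P (circ q t) := by
  unfold boundaryMeasure
  rw [ae_add_measure_iff, ae_circleMeasure_iff one_pos, ae_circleMeasure_iff hq.1]

instance (ρ : ℝ) : IsFiniteMeasure (circleMeasure ρ) := by unfold circleMeasure; infer_instance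
instance (q : ℝ) : IsFiniteMeasure (boundaryMeasure q) := by unfold boundaryMeasure; infer_instance

theorem memLp_comp_one {E : Type*} [NormedAddCommGroup E] {q : ℝ} {p : ℝ≥0∞} {f : ℂ → E}
    (hf : MemLp f p (boundaryMeasure q)) : MemLp (f ∘ circ 1) p angle :=
  (memLp_map_measure_iff (hf.mono_measure (Measure.le_add_right le_rfl)).1
    (measurable_circ 1).aemeasurable).1 (hf.mono_measure (Measure.le_add_right le_rfl))

theorem memLp_comp_q {E : Type*} [NormedAddCommGroup E] {q : ℝ} {p : ℝ≥0∞} {f : ℂ → E}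
    (hf : MemLp f p (boundaryMeasure q)) : MemLp (f ∘ circ q) p angle :=
  (memLp_map_measure_iff (hf.mono_measure (Measure.le_add_left le_rfl)).1
    (measurable_circ q).aemeasurable).1 (hf.mono_measure (Measure.le_add_left le_rfl))

theorem integral_boundary {E : Type*} [NormedAddCommGroup E] [NormedSpace ℝ E] {q : ℝ} {f : ℂ → E}
    (hf : Integrable f (boundaryMeasure q)) :
    ∫ z, f z ∂boundaryMeasure q = ∫ t, f (circ 1 t) ∂angle + ∫ t, f (circ q t) ∂angle := by
  have h1 := hf.mono_measure (ν := boundaryMeasure q) (μ := circleMeasure 1)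
    (Measure.le_add_right le_rfl)
  have h2 := hf.mono_measure (ν := boundaryMeasure q) (μ := circleMeasure q)
    (Measure.le_add_left le_rfl)
  unfold boundaryMeasure
  rw [integral_add_measure h1 h2]
  unfold circleMeasure at *
  rw [integral_map (measurable_circ _).aemeasurable h1.1,
    integral_map (measurable_circ _).aemeasurable h2.1]

/-! ### The Hardy space described by Fourier coefficients -/

theorem memLp_slice {q : ℝ} {F : ℂ → ℂ} (h : DifferentiableOn ℂ F (cover q)) {s : ℝ}
    (hs : s ∈ Ioo (Real.log q) 0) (p : ℝ≥0∞) : MemLp (slice F s) p angle := by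
  have hc := continuous_slice h hs
  obtain ⟨C, hC⟩ := (isCompact_Icc (a := -Real.pi) (b := Real.pi)).exists_bound_of_continuousOn
    hc.continuousOn
  exact MemLp.of_bound hc.aestronglyMeasurable C
    (ae_angle_mem.mono fun t ht => hC t (Ioc_subset_Icc_self ht))

/-- The Fourier coefficients of a modulus automorphic function over the circles of radius `e^s`. -/
theorem coef_slice {q α : ℝ} {F : ℂ → ℂ} (hF : DifferentiableOn ℂ F (cover q))
    (hi : ∀ w ∈ cover q, F (w + 2 * Real.pi * Complex.I) =
      Complex.exp (2 * Real.pi * Complex.I * α) * F w) (k : ℤ) :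
    ∃ A : ℂ, ∀ s ∈ Ioo (Real.log q) 0, coef (k + α) (slice F s) = (Real.exp ((k + α) * s) : ℝ) * A := by
  set b : ℝ := k + α with hb
  -- Since b and α differ by an integer, the exponential cancels the automorphy factor and G has
  -- period 2πi. In Cauchy's theorem on a rectangle of height 2π the horizontal sides cancel, so the
  -- integral over a vertical side does not depend on s.
  let G : ℂ → ℂ := fun w => F w * Complex.exp (-(b * w))
  have hG : DifferentiableOn ℂ G (cover q) := hF.mul (by fun_prop)
  have hper : ∀ w ∈ cover q, G (w + 2 * Real.pi * Complex.I) = G w := fun w hw => by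
    simp only [G, hi w hw]
    rw [mul_right_comm, mul_comm _ (F w), mul_comm (F w), mul_comm, ← Complex.exp_add]
    congr 1
    rw [Complex.exp_eq_exp_iff_exists_int]
    refine ⟨-k, ?_⟩
    rw [hb]; push_cast; ring
  let J : ℝ → ℂ := fun s => ∫ t in (-Real.pi)..Real.pi, G (s + t * Complex.I)
  have hJ : ∀ s₁ ∈ Ioo (Real.log q) 0, ∀ s₂ ∈ Ioo (Real.log q) 0, J s₁ = J s₂ := by
    intro s₁ h₁ s₂ h₂
    have := Complex.integral_boundary_rect_eq_zero_of_differentiableOn G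
      ⟨s₁, -Real.pi⟩ ⟨s₂, Real.pi⟩ (hG.mono fun w hw => by
        have h3 := ordConnected_Ioo.uIcc_subset h₁ h₂ (Complex.mem_reProdIm.1 hw).1
        exact h3)
    have he : ∫ x in s₁..s₂, G (x + (Real.pi : ℝ) * Complex.I) =
        ∫ x in s₁..s₂, G (x + (-Real.pi : ℝ) * Complex.I) := by
      refine intervalIntegral.integral_congr fun x hx => ?_
      have h3 := ordConnected_Ioo.uIcc_subset h₁ h₂ hx
      have h4 := hper (x + (-Real.pi : ℝ) * Complex.I) (by simpa [cover] using h3)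
      rw [← h4]; congr 1; push_cast; ring
    simp only [he] at this
    rw [sub_self, zero_add, ← smul_sub, smul_eq_zero, or_iff_right Complex.I_ne_zero] at this
    exact (sub_eq_zero.1 this).symm
  have hc : ∀ s : ℝ, coef b (slice F s) = (Real.exp (b * s) : ℝ) * J s := fun s => by
    simp only [coef, J, angle]
    rw [intervalIntegral.integral_of_le (by linarith [Real.pi_pos]), ← integral_const_mul]
    congr 1; funext t
    simp only [slice, G, char]
    rw [mul_left_comm]
    congr 1
    push_cast
    rw [← Complex.exp_add]
    congr 1; ring
  by_cases hne : (Ioo (Real.log q) (0 : ℝ)).Nonempty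
  · obtain ⟨s₀, h₀⟩ := hne
    exact ⟨J s₀, fun s hs => by rw [hc, hJ s hs s₀ h₀]⟩
  · exact ⟨0, fun s hs => absurd ⟨s, hs⟩ hne⟩

/-- The relation between the Fourier coefficients on the two boundary circles that characterizes
boundary functions of modulus automorphic functions of index `α`. -/
def CoefRel (q α : ℝ) (g : ℂ → ℂ) : Prop :=
  ∀ k : ℤ, coef (k + α) (g ∘ circ q) = (Real.exp ((k + α) * Real.log q) : ℝ) *
    coef (k + α) (g ∘ circ 1)

/-- Letting s → 0 identifies the free constant of `coef_slice` as the coefficient on the outer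
circle; letting s → log q afterwards gives `CoefRel`. -/
theorem coef_slice_eq {q α : ℝ} (hq : q ∈ Ioo (0 : ℝ) 1) {F g : ℂ → ℂ} (hF : IsHardy q α F)
    (hg : MemLp (g ∘ circ 1) 2 angle) (h : HasBoundaryValue q F g) (k : ℤ) {s : ℝ}
    (hs : s ∈ Ioo (Real.log q) 0) :
    coef (k + α) (slice F s) = (Real.exp ((k + α) * s) : ℝ) * coef (k + α) (g ∘ circ 1) := by
  obtain ⟨A, hA⟩ := coef_slice hF.analytic hF.index k
  have hev : ∀ᶠ s in 𝓝[<] (0 : ℝ), s ∈ Ioo (Real.log q) 0 :=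
    Ioo_mem_nhdsLT (Real.log_neg hq.1 hq.2)
  have h1 := tendsto_coef_of_L2 (hev.mono fun s hs => memLp_slice hF.analytic hs 2) hg
    h.outer_circle (k + α)
  have h2 : Tendsto (fun s : ℝ => ((Real.exp ((k + α) * s) : ℝ) : ℂ) * A) (𝓝[<] 0)
      (𝓝 (((Real.exp ((k + α) * 0) : ℝ) : ℂ) * A)) :=
    (Continuous.tendsto (by fun_prop) 0).mono_left nhdsWithin_le_nhds
  have h3 := tendsto_nhds_unique (h1.congr' (hev.mono fun s hs => hA s hs)) h2
  rw [hA s hs, h3]; simp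

theorem coefRel_of_isHardy {q α : ℝ} (hq : q ∈ Ioo (0 : ℝ) 1) {F g : ℂ → ℂ} (hF : IsHardy q α F)
    (hg : MemLp g 2 (boundaryMeasure q)) (h : HasBoundaryValue q F g) : CoefRel q α g := by
  intro k
  have hev : ∀ᶠ s in 𝓝[>] (Real.log q), s ∈ Ioo (Real.log q) 0 :=
    Ioo_mem_nhdsGT (Real.log_neg hq.1 hq.2)
  have h1 := tendsto_coef_of_L2 (hev.mono fun s hs => memLp_slice hF.analytic hs 2)
    (memLp_comp_q hg) h.inner_circle (k + α)
  have h2 : Tendsto (fun s : ℝ => ((Real.exp ((k + α) * s) : ℝ) : ℂ) * coef (k + α) (g ∘ circ 1))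
      (𝓝[>] (Real.log q))
      (𝓝 (((Real.exp ((k + α) * Real.log q) : ℝ) : ℂ) * coef (k + α) (g ∘ circ 1))) :=
    (Continuous.tendsto (by fun_prop) _).mono_left nhdsWithin_le_nhds
  exact tendsto_nhds_unique
    (h1.congr' (hev.mono fun s hs => coef_slice_eq hq hF (memLp_comp_one hg) h k hs)) h2

theorem summable_exp_neg_abs {δ : ℝ} (hδ : 0 < δ) (α : ℝ) :
    Summable fun k : ℤ => Real.exp (-(δ * |k + α|)) := by
  have h1 : Summable fun k : ℤ => Real.exp (-δ) ^ k.natAbs := by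
    have h := summable_geometric_of_lt_one (Real.exp_pos (-δ)).le
      (Real.exp_lt_one_iff.2 (by linarith))
    exact Summable.of_nat_of_neg (by simpa using h) (by simpa using h)
  refine (h1.mul_left (Real.exp (δ * |α|))).of_nonneg_of_le (fun _ => (Real.exp_pos _).le)
    fun k => ?_
  rw [← Real.exp_nat_mul, ← Real.exp_add]
  refine Real.exp_le_exp.2 ?_
  have h2 : |(k : ℝ)| ≤ |k + α| + |α| := by
    simpa using abs_sub (k + α : ℝ) α
  have h3 : ((k.natAbs : ℕ) : ℝ) = |(k : ℝ)| := by simp [Nat.cast_natAbs]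
  rw [h3]
  nlinarith

theorem exp_mul_le_add {q s b : ℝ} (hs : s ∈ Icc (Real.log q) 0) :
    Real.exp (b * s) ≤ 1 + Real.exp (b * Real.log q) := by
  rcases le_total 0 b with hb | hb
  · have : Real.exp (b * s) ≤ 1 := Real.exp_le_one_iff.2 (mul_nonpos_of_nonneg_of_nonpos hb hs.2)
    linarith [Real.exp_pos (b * Real.log q)]
  · have : Real.exp (b * s) ≤ Real.exp (b * Real.log q) :=
      Real.exp_le_exp.2 (mul_le_mul_of_nonpos_left hs.1 hb)
    linarith

section Converse

variable {q α : ℝ} {g : ℂ → ℂ}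

/-- F is the Laurent type series with terms (2π)⁻¹ x_k e^{(k+α)w}. The outer coefficients x control
the positive frequencies and, through `CoefRel`, the inner coefficients y control the negative ones.
Parseval then turns the bound on the means and both boundary limits into statements about square
sums. -/
theorem isHardy_of_coefRel (hq : q ∈ Ioo (0 : ℝ) 1) (hg : MemLp g 2 (boundaryMeasure q))
    (h : CoefRel q α g) : ∃ F, IsHardy q α F ∧ HasBoundaryValue q F g := by
  have hlog := Real.log_neg hq.1 hq.2
  have hg1 := memLp_comp_one hg
  have hgq := memLp_comp_q hg
  set x : ℤ → ℂ := fun k => coef (k + α) (g ∘ circ 1) with hx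
  set y : ℤ → ℂ := fun k => coef (k + α) (g ∘ circ q) with hy
  have hxy : ∀ k, y k = (Real.exp ((k + α) * Real.log q) : ℝ) * x k := h
  have hnxy : ∀ k, ‖y k‖ = Real.exp ((k + α) * Real.log q) * ‖x k‖ := fun k => by
    rw [hxy, norm_mul, Complex.norm_real, Real.norm_of_nonneg (Real.exp_pos _).le]
  have sx := (hasSum_sq_coef hg1 α).summable
  have sy := (hasSum_sq_coef hgq α).summable
  -- A common majorant for the square sums below; the terms there are at most (‖x k‖ + ‖y k‖)², so
  -- any factor from 2 on would serve.
  have sxy : Summable fun k : ℤ => 8 * (‖x k‖ ^ 2 + ‖y k‖ ^ 2) := (sx.add sy).mul_left 8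
  obtain ⟨C, hC0, hCx, hCy⟩ : ∃ C : ℝ, 0 ≤ C ∧ (∀ k, ‖x k‖ ≤ C) ∧ ∀ k, ‖y k‖ ≤ C := by
    refine ⟨max (∫ t, ‖(g ∘ circ 1) t‖ ∂angle) (∫ t, ‖(g ∘ circ q) t‖ ∂angle),
      le_max_of_le_left (integral_nonneg fun _ => norm_nonneg _),
      fun k => (norm_coef_le _ _).trans (le_max_left _ _),
      fun k => (norm_coef_le _ _).trans (le_max_right _ _)⟩
  let T : ℤ → ℂ → ℂ := fun k w => (2 * Real.pi : ℂ)⁻¹ * x k * Complex.exp (((k + α : ℝ) : ℂ) * w)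
  let F : ℂ → ℂ := fun w => ∑' k, T k w
  have hTn : ∀ k w, ‖T k w‖ = (2 * Real.pi)⁻¹ * (‖x k‖ * Real.exp ((k + α) * w.re)) := fun k w => by
    simp only [T, norm_mul, Complex.norm_exp, Complex.re_ofReal_mul, norm_inv]
    rw [mul_assoc]
    congr 1
    have : ((2 : ℂ) * Real.pi) = ((2 * Real.pi : ℝ) : ℂ) := by push_cast; rfl
    simp [abs_of_pos Real.pi_pos]
  have hTb : ∀ s₀ s₁, ∀ k w, w.re ∈ Icc s₀ s₁ → ‖T k w‖ ≤
      (2 * Real.pi)⁻¹ * (C * Real.exp (-(min (-s₁) (s₀ - Real.log q) * |k + α|))) := by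
    intro s₀ s₁ k w hw
    rw [hTn]
    refine mul_le_mul_of_nonneg_left ?_ (by have := Real.pi_pos; positivity)
    rcases le_total 0 (k + α : ℝ) with hb | hb
    · refine mul_le_mul (hCx k) (Real.exp_le_exp.2 ?_) (Real.exp_pos _).le hC0
      rw [abs_of_nonneg hb]
      nlinarith [hw.1, hw.2, min_le_left (-s₁) (s₀ - Real.log q)]
    -- For negative frequencies the growth is measured from the inner circle: x_k e^{(k+α)s} has the
    -- size of y_k e^{(k+α)(s - log q)}, which decays as |k| grows.
    · have h1 : ‖x k‖ * Real.exp ((k + α) * w.re) =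
          ‖y k‖ * Real.exp ((k + α) * (w.re - Real.log q)) := by
        rw [hnxy, mul_right_comm, ← Real.exp_add, mul_comm]; congr 2; ring
      rw [h1]
      refine mul_le_mul (hCy k) (Real.exp_le_exp.2 ?_) (Real.exp_pos _).le hC0
      rw [abs_of_nonpos hb]
      nlinarith [hw.1, hw.2, min_le_right (-s₁) (s₀ - Real.log q)]
  have hsum : ∀ s₀ s₁ : ℝ, Real.log q < s₀ → s₁ < 0 → Summable fun k : ℤ =>
      (2 * Real.pi)⁻¹ * (C * Real.exp (-(min (-s₁) (s₀ - Real.log q) * |k + α|))) := by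
    intro s₀ s₁ h0 h1
    exact ((summable_exp_neg_abs (lt_min (by linarith) (by linarith)) α).mul_left C).mul_left _
  have hTd : ∀ k, Differentiable ℂ (T k) := fun k => by fun_prop
  have hFd : DifferentiableOn ℂ F (cover q) := by
    intro w hw
    obtain ⟨s₀, h0, h0'⟩ := exists_between hw.1
    obtain ⟨s₁, h1, h1'⟩ := exists_between hw.2
    have hopen : IsOpen {z : ℂ | s₀ < z.re ∧ z.re < s₁} :=
      (isOpen_lt continuous_const Complex.continuous_re).inter
        (isOpen_lt Complex.continuous_re continuous_const)
    refine ((Complex.differentiableOn_tsum_of_summable_norm (hsum s₀ s₁ h0 h1')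
      (fun k => (hTd k).differentiableOn) hopen fun k z hz =>
        hTb s₀ s₁ k z ⟨hz.1.le, hz.2.le⟩).differentiableAt
        (hopen.mem_nhds ⟨h0', h1⟩)).differentiableWithinAt
  have hTs : ∀ k (s t : ℝ), T k (s + t * Complex.I) =
      (2 * Real.pi : ℂ)⁻¹ * x k * (Real.exp ((k + α) * s) : ℝ) * char (k + α) t := fun k s t => by
    simp only [T, char]
    rw [mul_assoc (_ * _)]
    congr 1
    push_cast
    rw [← Complex.exp_add]; congr 1; ring
  have hcF : ∀ s ∈ Ioo (Real.log q) 0, ∀ k : ℤ,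
      coef (k + α) (slice F s) = (Real.exp ((k + α) * s) : ℝ) * x k := by
    intro s hs k
    have hre : ∀ t : ℝ, ((s : ℂ) + t * Complex.I).re = s := fun t => by simp
    have hb : ∀ j (t : ℝ), ‖T j (s + t * Complex.I)‖ ≤ _ := fun j t =>
      hTb s s j _ (by rw [hre]; exact ⟨le_rfl, le_rfl⟩)
    have hcont : ∀ j, Continuous fun t : ℝ => T j (s + t * Complex.I) := fun j =>
      (hTd j).continuous.comp (by fun_prop)
    have hsumI := hasSum_integral_of_summable_integral_norm (μ := angle)
      (F := fun (j : ℤ) (t : ℝ) => T j (s + t * Complex.I) * char (-(k + α)) t)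
      (fun j => (Integrable.of_bound (hcont j).aestronglyMeasurable _
        (Eventually.of_forall (hb j))).mul_bdd (c := 1) (continuous_char _).aestronglyMeasurable
          (by simp)) (by
        refine ((hsum s s hs.1 hs.2).mul_left (angle.real univ)).of_nonneg_of_le
          (fun j => integral_nonneg fun _ => norm_nonneg _) fun j => ?_
        simp only [norm_mul, norm_char, mul_one]
        refine (integral_mono_of_nonneg (Eventually.of_forall fun _ => norm_nonneg _)
          (integrable_const _) (Eventually.of_forall (hb j))).trans_eq ?_
        rw [integral_const, smul_eq_mul])
    have hlhs : (fun t : ℝ => ∑' j, T j (s + t * Complex.I) * char (-(k + α)) t) =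
        fun t : ℝ => slice F s t * char (-(k + α)) t := by
      funext t; rw [tsum_mul_right]; rfl
    rw [hlhs] at hsumI
    refine hsumI.unique ?_
    have hterm : ∀ j : ℤ, ∫ t, T j (s + t * Complex.I) * char (-(k + α)) t ∂angle =
        (2 * Real.pi : ℂ)⁻¹ * x j * (Real.exp ((j + α) * s) : ℝ) * coef (k + α) (char (j + α)) := by
      intro j
      simp_rw [hTs]
      exact coef_const_mul _ (k + α) (char (j + α))
    simp_rw [hterm]
    have h2 : (Real.exp ((k + α) * s) : ℝ) * x k =
        (2 * Real.pi : ℂ)⁻¹ * x k * (Real.exp ((k + α) * s) : ℝ) * coef (k + α) (char (k + α)) := by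
      rw [coef_char_self]
      have : (2 * Real.pi : ℂ) ≠ 0 := by exact_mod_cast Real.two_pi_pos.ne'
      field_simp
    rw [h2]
    exact hasSum_single k fun j hj => by rw [coef_char_ne hj.symm, mul_zero]
  have hm : ∀ s ∈ Ioo (Real.log q) 0, MemLp (slice F s) 2 angle := fun s hs => memLp_slice hFd hs 2
  -- Serves both circles, with s₀ = 0 and s₀ = log q: the differences of coefficients tend to 0
  -- termwise and are dominated by `sxy`.
  have hlim : ∀ (s₀ : ℝ) (l : Filter ℝ) (u : ℝ → ℂ), s₀ ∈ Icc (Real.log q) 0 → l ≤ 𝓝 s₀ →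
      (∀ᶠ s in l, s ∈ Ioo (Real.log q) 0) → MemLp u 2 angle →
      (∀ k : ℤ, coef (k + α) u = (Real.exp ((k + α) * s₀) : ℝ) * x k) →
      Tendsto (fun s => eLpNorm (slice F s - u) 2 angle) l (𝓝 0) := by
    intro s₀ l u hs₀ hl hev hu huc
    have e1 : ∀ s ∈ Ioo (Real.log q) 0, ∀ k : ℤ, coef (k + α) (slice F s - u) =
        ((Real.exp ((k + α) * s) - Real.exp ((k + α) * s₀) : ℝ) : ℂ) * x k := fun s hs k => by
      have := coef_sub ((hm s hs).integrable (by norm_num)) (hu.integrable (by norm_num)) (k + α)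
      rw [hcF s hs, huc, ← sub_mul] at this
      push_cast at this ⊢
      exact this
    have e2 : Tendsto (fun s => ∑' k : ℤ,
        ‖((Real.exp ((k + α) * s) - Real.exp ((k + α) * s₀) : ℝ) : ℂ) * x k‖ ^ 2) l
        (𝓝 (∑' k : ℤ, (0 : ℝ))) := by
      refine tendsto_tsum_of_dominated_convergence sxy (fun k => ?_) ?_
      · have : Continuous fun s : ℝ =>
            ‖((Real.exp ((k + α) * s) - Real.exp ((k + α) * s₀) : ℝ) : ℂ) * x k‖ ^ 2 := by fun_prop
        simpa using (this.tendsto s₀).mono_left hl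
      · filter_upwards [hev] with s hs k
        have a1 := exp_mul_le_add (b := k + α) (Ioo_subset_Icc_self hs)
        have a2 := exp_mul_le_add (b := k + α) hs₀
        have a3 : |Real.exp ((k + α) * s) - Real.exp ((k + α) * s₀)| ≤
            1 + Real.exp ((k + α) * Real.log q) :=
          abs_le.2 ⟨by linarith [Real.exp_pos ((k + α) * s)],
            by linarith [Real.exp_pos ((k + α) * s₀)]⟩
        have a4 : ‖((Real.exp ((k + α) * s) - Real.exp ((k + α) * s₀) : ℝ) : ℂ) * x k‖ ≤
            ‖x k‖ + ‖y k‖ := by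
          rw [norm_mul, Complex.norm_real, Real.norm_eq_abs, hnxy]
          nlinarith [norm_nonneg (x k)]
        rw [Real.norm_of_nonneg (by positivity)]
        nlinarith [norm_nonneg (((Real.exp ((k + α) * s) - Real.exp ((k + α) * s₀) : ℝ) : ℂ) * x k),
          sq_nonneg (‖x k‖ - ‖y k‖), norm_nonneg (x k), norm_nonneg (y k)]
    rw [tsum_zero] at e2
    have e3 : Tendsto (fun v : ℝ => ENNReal.ofReal (Real.sqrt ((2 * Real.pi)⁻¹ * v))) (𝓝 0) (𝓝 0) := by
      have : Continuous (fun v : ℝ => ENNReal.ofReal (Real.sqrt ((2 * Real.pi)⁻¹ * v))) :=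
        ENNReal.continuous_ofReal.comp (by fun_prop)
      simpa using this.tendsto 0
    refine (e3.comp e2).congr' ?_
    filter_upwards [hev] with s hs
    rw [eLpNorm_two_eq_sqrt_tsum ((hm s hs).sub hu) α]
    simp only [Function.comp_apply, e1 s hs]
  refine ⟨F, ⟨hFd, fun w hw => ?_, ?_⟩, ⟨?_, ?_⟩⟩
  · simp only [F, T, ← tsum_mul_left]
    congr 1; funext k
    rw [mul_left_comm]
    congr 1
    rw [← Complex.exp_add, Complex.exp_eq_exp_iff_exists_int]
    exact ⟨k, by push_cast; ring⟩
  · refine ⟨Real.toNNReal (Real.sqrt ((2 * Real.pi)⁻¹ * ∑' k : ℤ, 8 * (‖x k‖ ^ 2 + ‖y k‖ ^ 2))),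
      fun s hs => ?_⟩
    rw [eLpNorm_two_eq_sqrt_tsum (hm s hs) α]
    refine ENNReal.ofReal_le_ofReal (Real.sqrt_le_sqrt ?_)
    refine mul_le_mul_of_nonneg_left ?_ (by have := Real.pi_pos; positivity)
    refine Summable.tsum_le_tsum (fun k => ?_) (hasSum_sq_coef (hm s hs) α).summable sxy
    rw [hcF s hs]
    have a1 := exp_mul_le_add (b := k + α) (Ioo_subset_Icc_self hs)
    have a4 : ‖((Real.exp ((k + α) * s) : ℝ) : ℂ) * x k‖ ≤ ‖x k‖ + ‖y k‖ := by
      rw [norm_mul, Complex.norm_real, Real.norm_of_nonneg (Real.exp_pos _).le, hnxy]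
      nlinarith [norm_nonneg (x k)]
    nlinarith [norm_nonneg (((Real.exp ((k + α) * s) : ℝ) : ℂ) * x k),
          sq_nonneg (‖x k‖ - ‖y k‖), norm_nonneg (x k), norm_nonneg (y k)]
  · refine hlim 0 _ _ ⟨hlog.le, le_rfl⟩ nhdsWithin_le_nhds (Ioo_mem_nhdsLT hlog) hg1 fun k => ?_
    simp [hx]
  · exact hlim (Real.log q) _ _ ⟨le_rfl, hlog.le⟩ nhdsWithin_le_nhds (Ioo_mem_nhdsGT hlog) hgq hxy

end Converse

theorem mem_hardySpace_iff {q : ℝ} (hq : q ∈ Ioo (0 : ℝ) 1) {α : ℝ}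
    {g : Lp ℂ 2 (boundaryMeasure q)} : g ∈ hardySpace hq α ↔ CoefRel q α g :=
  ⟨fun ⟨_, hF, hb⟩ => coefRel_of_isHardy hq hF (Lp.memLp g) hb,
    fun h => isHardy_of_coefRel hq (Lp.memLp g) h⟩

/-! ### Two facts on Hilbert and Banach space operators -/

/-- A compression `P E P` of an orthogonal projection `E`, whose off-diagonal part is compact and
nonzero, has an eigenvalue strictly between `0` and `1`. -/
theorem exists_eigenvector_compression {K : Type*} [NormedAddCommGroup K] [InnerProductSpace ℂ K]
    [CompleteSpace K] {P E : K →L[ℂ] K} (hP : IsSelfAdjoint P) (hP2 : P * P = P)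
    (hE : IsSelfAdjoint E) (hE2 : E * E = E) (hZ : IsCompactOperator ((1 - P) * E * P : K →L[ℂ] K))
    (hne : (1 - P) * E * P ≠ 0) :
    ∃ μ ∈ Ioo (0 : ℝ) 1, ∃ v : K, v ≠ 0 ∧ P v = v ∧ P (E v) = (μ : ℂ) • v := by
  set Z := (1 - P) * E * P with hZdef
  set a := P * E * P with ha
  have hstar : star Z = P * E * (1 - P) := by
    simp only [hZdef, star_mul, star_sub, star_one, hP.star_eq, hE.star_eq, mul_assoc]
  -- Compactness is assumed of Z only, not of a = PEP, so the spectral theorem is applied to Z*Z = a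
  -- - a² and an eigenvector of a is extracted from it.
  have hC : star Z * Z = a - a * a := by
    have h1 : (1 - P) * (1 - P) = 1 - P := by simp [mul_sub, sub_mul, hP2]
    calc star Z * Z = P * E * ((1 - P) * (1 - P)) * E * P := by
          rw [hstar, hZdef]; simp only [mul_assoc]
      _ = P * (E * E) * P - P * E * P * E * P := by
          rw [h1]; simp only [mul_sub, sub_mul, mul_one, mul_assoc]
      _ = P * E * P - P * E * (P * P) * E * P := by rw [hE2, hP2]
      _ = a - a * a := by rw [ha]; simp only [mul_assoc]
  have hCc : IsCompactOperator (star Z * Z : K →L[ℂ] K) := hZ.clm_comp (star Z)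
  have hCs : (star Z * Z : K →L[ℂ] K).IsSymmetric :=
    (IsSelfAdjoint.star_mul_self Z).isSymmetric
  have hC0 : star Z * Z ≠ 0 := fun h => hne (CStarRing.star_mul_self_eq_zero_iff Z |>.1 h)
  obtain ⟨κ, hκ, hκ0⟩ : ∃ κ : ℂ,
      Module.End.HasEigenvalue ((star Z * Z : K →L[ℂ] K) : K →ₗ[ℂ] K) κ ∧ κ ≠ 0 := by
    by_contra! hcon
    exact hC0 ((ContinuousLinearMap.eq_zero_of_forall_hasEigenvalue_eq_zero hCc hCs).1 hcon)
  obtain ⟨v₀, hv₀⟩ := hκ.exists_hasEigenvector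
  have hv0 : v₀ ≠ 0 := hv₀.2
  have hκv : a v₀ - a (a v₀) = κ • v₀ := by
    have := hv₀.apply_eq_smul
    rw [hC] at this
    exact this
  obtain ⟨μ, hμ⟩ : ∃ μ : ℂ, μ - μ * μ = κ := by
    obtain ⟨s, hs⟩ := IsAlgClosed.exists_pow_nat_eq (1 - 4 * κ) (n := 2) two_pos
    exact ⟨(1 + s) / 2, by linear_combination -hs / 4⟩
  -- With κ = μ(1 - μ), the vector v₀ is killed by (a - μ)(a - (1 - μ)). Hence either v₀ is an
  -- eigenvector of a for 1 - μ, or (a - (1 - μ)) v₀ is one for μ. In both cases ν(1 - ν) = κ ≠ 0,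
  -- which rules out ν = 0 and ν = 1.
  obtain ⟨ν, hν, v, hv, hav⟩ : ∃ ν : ℂ, ν - ν * ν = κ ∧ ∃ v, v ≠ 0 ∧ a v = ν • v := by
    by_cases h : a v₀ - (1 - μ) • v₀ = 0
    · exact ⟨1 - μ, by linear_combination hμ, v₀, hv0, sub_eq_zero.1 h⟩
    · refine ⟨μ, hμ, _, h, ?_⟩
      have : a (a v₀) = a v₀ - κ • v₀ := by rw [← hκv]; abel
      rw [map_sub, map_smul, this, ← hμ]
      module
  have hν0 : ν ≠ 0 := by rintro rfl; apply hκ0; rw [← hν]; ring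
  have hν1 : ν ≠ 1 := by rintro rfl; apply hκ0; rw [← hν]; ring
  have hPv : P v = v := by
    have h1 : P (a v) = a v := by
      show (P * (P * E * P)) v = _
      rw [← mul_assoc, ← mul_assoc, hP2]
    rw [hav, map_smul] at h1
    exact smul_right_injective K hν0 h1
  have hPE : P (E v) = ν • v := by
    rw [← hav]; show _ = P (E (P v)); rw [hPv]
  have hEs : ∀ x y, inner ℂ (E x) y = inner ℂ x (E y) := hE.isSymmetric
  have hPs : ∀ x y, inner ℂ (P x) y = inner ℂ x (P y) := hP.isSymmetric
  have hEE : ∀ x, E (E x) = E x := fun x => congr($hE2 x)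
  have hEv : inner ℂ v (E v) = inner ℂ (E v) (E v) := by rw [hEs, hEE]
  have hnorm : ν * (‖v‖ : ℂ) ^ 2 = (‖E v‖ : ℂ) ^ 2 := by
    have h1 : inner ℂ v (P (E v)) = ν * (‖v‖ : ℂ) ^ 2 := by
      rw [hPE, inner_smul_right, inner_self_eq_norm_sq_to_K]; rfl
    have h2 : inner ℂ v (P (E v)) = (‖E v‖ : ℂ) ^ 2 := by
      rw [← hPs, hPv, hEv, inner_self_eq_norm_sq_to_K]; rfl
    rw [← h1, h2]
  have hvn : 0 < ‖v‖ := norm_pos_iff.2 hv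
  -- Since v lies in the range of P, ν‖v‖² = ⟨v, PEv⟩ = ‖Ev‖², so ν is real and lies in [0, 1].
  have hνr : ν = ((‖E v‖ ^ 2 / ‖v‖ ^ 2 : ℝ) : ℂ) := by
    have : (‖v‖ : ℂ) ≠ 0 := by exact_mod_cast hvn.ne'
    push_cast
    rw [eq_div_iff (pow_ne_zero 2 this), hnorm]
  have hle : ‖E v‖ ≤ ‖v‖ := by
    have h1 : ‖E v‖ ^ 2 ≤ ‖v‖ * ‖E v‖ := by
      have h2 : inner ℂ v (E v) = ((‖E v‖ ^ 2 : ℝ) : ℂ) := by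
        rw [hEv, inner_self_eq_norm_sq_to_K]; push_cast; rfl
      have := norm_inner_le_norm (𝕜 := ℂ) v (E v)
      rw [h2, Complex.norm_real, Real.norm_of_nonneg (by positivity)] at this
      exact this
    rcases eq_or_lt_of_le (norm_nonneg (E v)) with h | h
    · rw [← h]; exact hvn.le
    · nlinarith
  refine ⟨‖E v‖ ^ 2 / ‖v‖ ^ 2, ⟨?_, ?_⟩, v, hv, hPv, by rw [hPE, hνr]⟩
  · refine lt_of_le_of_ne (by positivity) fun h => hν0 ?_
    rw [hνr, ← h]; simp
  · refine lt_of_le_of_ne (div_le_one_of_le₀ (by gcongr) (by positivity)) fun h => hν1 ?_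
    rw [hνr, h]; simp

/-- An operator of the form `∑ φ_k(·) y_k` with absolutely summable terms is compact. -/
theorem isCompactOperator_of_hasSum {ι K : Type*} [NormedAddCommGroup K] [NormedSpace ℂ K]
    [CompleteSpace K] {Z : K →L[ℂ] K} {φ : ι → K →L[ℂ] ℂ} {y : ι → K}
    (hs : Summable fun k => ‖φ k‖ * ‖y k‖) (hZ : ∀ v, HasSum (fun k => φ k v • y k) (Z v)) :
    IsCompactOperator Z := by
  have hS : Summable fun k => (φ k).smulRight (y k) :=
    Summable.of_norm (by simpa using hs)
  have hZ' : HasSum (fun k => (φ k).smulRight (y k)) Z := by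
    convert hS.hasSum
    ext v
    refine (hZ v).unique ?_
    exact hS.hasSum.mapL (ContinuousLinearMap.apply ℂ K v)
  have hcl : IsClosed {f : K →L[ℂ] K | IsCompactOperator f} := isClosed_setOfPred_isCompactOperator
  refine hcl.mem_of_tendsto hZ' (Eventually.of_forall fun s => ?_)
  have : (∑ k ∈ s, (φ k).smulRight (y k)) ∈ compactOperator (RingHom.id ℂ) K K := by
    refine Submodule.sum_mem _ fun k _ => ?_
    have h1 : IsCompactOperator (φ k) := by
      refine ⟨Metric.closedBall 0 1, isCompact_closedBall 0 1, ?_⟩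
      exact (φ k).continuous.continuousAt.preimage_mem_nhds
        (by simpa using Metric.closedBall_mem_nhds (0 : ℂ) one_pos)
    exact h1.clm_comp (ContinuousLinearMap.toSpanSingleton ℂ (y k))
  exact this

/-! ### Multiplication operators, change of index, and the weak eigenvalue equation -/

section Multiplication

variable {X : Type*} [MeasurableSpace X] {μ : Measure X}

/-- Multiplication by a bounded function on `L²`. -/
def mulOp {m : X → ℂ} (hm : MemLp m ∞ μ) : Lp ℂ 2 μ →L[ℂ] Lp ℂ 2 μ :=
  (ContinuousLinearMap.mul ℂ ℂ).holderL μ ∞ 2 2 hm.toLp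

theorem coeFn_mulOp {m : X → ℂ} (hm : MemLp m ∞ μ) (f : Lp ℂ 2 μ) :
    mulOp hm f =ᵐ[μ] fun z => m z * f z := by
  have h : mulOp hm f = (ContinuousLinearMap.mul ℂ ℂ).holder 2 hm.toLp f := rfl
  rw [h]
  filter_upwards [(ContinuousLinearMap.mul ℂ ℂ).coeFn_holder (r := 2) hm.toLp f, hm.coeFn_toLp]
    with z h1 h2
  rw [h1, h2]; rfl

theorem inner_L2 (f g : Lp ℂ 2 μ) :
    inner ℂ f g = ∫ z, (starRingEnd ℂ) (f z) * g z ∂μ := by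
  rw [L2.inner_def]
  congr 1; funext z
  rw [RCLike.inner_apply, mul_comm]

theorem integrable_conj_mul (f g : Lp ℂ 2 μ) :
    Integrable (fun z => (starRingEnd ℂ) (f z) * g z) μ := by
  have := L2.integrable_inner (𝕜 := ℂ) f g
  simp only [RCLike.inner_apply'] at this
  exact this

end Multiplication

theorem circ_cpow {ρ t : ℝ} (hρ : 0 < ρ) (ht : t ∈ Ioc (-Real.pi) Real.pi) (b : ℝ) :
    circ ρ t ^ (b : ℂ) = (Real.exp (b * Real.log ρ) : ℝ) * char b t := by
  have h0 : circ ρ t ≠ 0 := by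
    rw [← norm_ne_zero_iff, norm_circ hρ.le]; exact hρ.ne'
  rw [Complex.cpow_def_of_ne_zero h0, Complex.log, norm_circ hρ.le, arg_circ hρ ht, char]
  push_cast
  rw [← Complex.exp_add]; congr 1; ring

theorem coef_cpow_mul {ρ : ℝ} (hρ : 0 < ρ) (a b : ℝ) (g : ℂ → ℂ) :
    coef (a + b) ((fun z => z ^ (b : ℂ) * g z) ∘ circ ρ) =
      (Real.exp (b * Real.log ρ) : ℝ) * coef a (g ∘ circ ρ) := by
  rw [← coef_mul_char b a, ← coef_const_mul]
  refine coef_congr ?_ _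
  filter_upwards [ae_angle_mem] with t ht
  simp only [Function.comp_apply, circ_cpow hρ ht]
  ring

theorem CoefRel.congr {q α : ℝ} {g h : ℂ → ℂ} (hg : CoefRel q α g)
    (hgh : g =ᵐ[boundaryMeasure q] h) : CoefRel q α h := by
  intro k
  rw [← coef_congr ((quasi_one q).ae_eq_comp hgh), ← coef_congr ((quasi_q q).ae_eq_comp hgh)]
  exact hg k

/-- The principal power uses the same branch -π < t ≤ π as the boundary functions, so multiplying by
z^b shifts all frequencies by b and contributes exactly the extra factor q^b on the inner circle.
This moves between Hardy spaces of different index. -/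
theorem CoefRel.cpow_mul {q α : ℝ} (hq : q ∈ Ioo (0 : ℝ) 1) {g : ℂ → ℂ} (hg : CoefRel q α g)
    (b : ℝ) : CoefRel q (α + b) (fun z => z ^ (b : ℂ) * g z) := by
  intro k
  rw [← add_assoc, coef_cpow_mul hq.1, coef_cpow_mul one_pos, hg k, Real.log_one, mul_zero,
    Real.exp_zero, add_mul _ b, Real.exp_add]
  push_cast; ring

theorem coefRel_add_int_iff {q α : ℝ} {g : ℂ → ℂ} (n : ℤ) :
    CoefRel q (α + n) g ↔ CoefRel q α g := by
  refine ⟨fun h k => ?_, fun h k => ?_⟩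
  · have := h (k - n)
    have e : ((k - n : ℤ) : ℝ) + (α + n) = k + α := by push_cast; ring
    rwa [e] at this
  · have := h (k + n)
    have e : ((k + n : ℤ) : ℝ) + α = k + (α + n) := by push_cast; ring
    rwa [e] at this

theorem memLp_top_of_bounds {q C : ℝ} (hq : q ∈ Ioo (0 : ℝ) 1) {m : ℂ → ℂ}
    (hm : AEStronglyMeasurable m (boundaryMeasure q)) (h1 : ∀ᵐ t ∂angle, ‖m (circ 1 t)‖ ≤ C)
    (h2 : ∀ᵐ t ∂angle, ‖m (circ q t)‖ ≤ C) : MemLp m ∞ (boundaryMeasure q) :=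
  memLp_top_of_bound hm C ((ae_boundary_iff hq).2 ⟨h1, h2⟩)

theorem memLp_cpow {q : ℝ} (hq : q ∈ Ioo (0 : ℝ) 1) (b : ℝ) :
    MemLp (fun z : ℂ => z ^ (b : ℂ)) ∞ (boundaryMeasure q) := by
  refine memLp_top_of_bounds (C := max 1 (Real.exp (b * Real.log q))) hq
    (by fun_prop : Measurable fun z : ℂ => z ^ (b : ℂ)).aestronglyMeasurable ?_ ?_
  · filter_upwards [ae_angle_mem] with t ht
    simp [circ_cpow one_pos ht]
  · filter_upwards [ae_angle_mem] with t ht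
    rw [circ_cpow hq.1 ht, norm_mul, norm_char, mul_one, Complex.norm_real,
      Real.norm_of_nonneg (Real.exp_pos _).le]
    exact le_max_right _ _

theorem mulOp_cpow_mem {q α : ℝ} (hq : q ∈ Ioo (0 : ℝ) 1) {g : Lp ℂ 2 (boundaryMeasure q)}
    (hg : g ∈ hardySpace hq α) (b : ℝ) : mulOp (memLp_cpow hq b) g ∈ hardySpace hq (α + b) :=
  (mem_hardySpace_iff hq).2 ((((mem_hardySpace_iff hq).1 hg).cpow_mul hq b).congr
    (coeFn_mulOp _ _).symm)

theorem hardySpace_add_int {q : ℝ} (hq : q ∈ Ioo (0 : ℝ) 1) (α : ℝ) (n : ℤ) :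
    hardySpace hq (α + n) = hardySpace hq α := by
  ext g
  rw [mem_hardySpace_iff, mem_hardySpace_iff, coefRel_add_int_iff]

/-- c g is its own projection, so the equation says that (φ - c) g projects to 0; being orthogonal
to the closure is the same as being orthogonal to the space. -/
theorem toeplitz_eq_smul_iff {q α : ℝ} (hq : q ∈ Ioo (0 : ℝ) 1) (φ : Lp ℝ ∞ (boundaryMeasure q))
    (g : hardySpace hq α) (c : ℂ) :
    toeplitz hq α φ g = c • (g : Lp ℂ 2 (boundaryMeasure q)) ↔
      ∀ h ∈ hardySpace hq α, ∫ z, (starRingEnd ℂ) (h z) *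
        ((φ z - c) * (g : Lp ℂ 2 (boundaryMeasure q)) z) ∂boundaryMeasure q = 0 := by
  obtain ⟨g', hg'⟩ := g
  have h1 : (hardySpace hq α).topologicalClosure.starProjection (c • g') = c • g' :=
    Submodule.starProjection_eq_self_iff.2
      (Submodule.smul_mem _ _ (Submodule.le_topologicalClosure _ hg'))
  unfold toeplitz
  rw [← sub_eq_zero, ← h1, ← map_sub, Submodule.starProjection_apply_eq_zero_iff,
    Submodule.orthogonal_closure, Submodule.mem_orthogonal]
  refine forall₂_congr fun h _ => ?_
  rw [inner_L2]
  refine Eq.congr_left (integral_congr_ae ?_)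
  filter_upwards [Lp.coeFn_sub (φ • g' : Lp ℂ 2 (boundaryMeasure q)) (c • g'),
    Lp.coeFn_smul c g', Lp.coeFn_lpSMul (r := 2) φ g'] with z e1 e2 e3
  rw [e1, Pi.sub_apply, e2, e3]
  simp only [Pi.smul_apply, Pi.smul_apply', Complex.real_smul, smul_eq_mul]
  ring

theorem continuous_coef_one (q b : ℝ) :
    Continuous fun g : Lp ℂ 2 (boundaryMeasure q) => coef b (g ∘ circ 1) := by
  refine continuous_iff_continuousAt.2 fun g => ?_
  refine tendsto_coef_of_L2 (Eventually.of_forall fun h => memLp_comp_one (Lp.memLp h))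
    (memLp_comp_one (Lp.memLp g)) ?_ b
  have h1 := (Lp.tendsto_Lp_iff_tendsto_eLpNorm' (fun h : Lp ℂ 2 (boundaryMeasure q) => h) g).1
    tendsto_id
  refine tendsto_of_tendsto_of_tendsto_of_le_of_le tendsto_const_nhds h1 (fun _ => zero_le)
    fun h => ?_
  have h2 : AEStronglyMeasurable ((h : ℂ → ℂ) - (g : ℂ → ℂ)) (circleMeasure 1) :=
    (((Lp.memLp h).sub (Lp.memLp g)).mono_measure (Measure.le_add_right le_rfl)).1
  have h3 := eLpNorm_map_measure (p := 2) h2 (measurable_circ 1).aemeasurable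
  exact h3.symm.trans_le (eLpNorm_mono_measure _ (Measure.le_add_right le_rfl))

theorem continuous_coef_q (q b : ℝ) :
    Continuous fun g : Lp ℂ 2 (boundaryMeasure q) => coef b (g ∘ circ q) := by
  refine continuous_iff_continuousAt.2 fun g => ?_
  refine tendsto_coef_of_L2 (Eventually.of_forall fun h => memLp_comp_q (Lp.memLp h))
    (memLp_comp_q (Lp.memLp g)) ?_ b
  have h1 := (Lp.tendsto_Lp_iff_tendsto_eLpNorm' (fun h : Lp ℂ 2 (boundaryMeasure q) => h) g).1
    tendsto_id
  refine tendsto_of_tendsto_of_tendsto_of_le_of_le tendsto_const_nhds h1 (fun _ => zero_le)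
    fun h => ?_
  have h2 : AEStronglyMeasurable ((h : ℂ → ℂ) - (g : ℂ → ℂ)) (circleMeasure q) :=
    (((Lp.memLp h).sub (Lp.memLp g)).mono_measure (Measure.le_add_left le_rfl)).1
  have h3 := eLpNorm_map_measure (p := 2) h2 (measurable_circ q).aemeasurable
  exact h3.symm.trans_le (eLpNorm_mono_measure _ (Measure.le_add_left le_rfl))

/-- Each relation of `CoefRel` equates two L²-continuous functionals. -/
theorem isClosed_hardySpace {q : ℝ} (hq : q ∈ Ioo (0 : ℝ) 1) (α : ℝ) :
    IsClosed (hardySpace hq α : Set (Lp ℂ 2 (boundaryMeasure q))) := by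
  have : (hardySpace hq α : Set (Lp ℂ 2 (boundaryMeasure q))) =
      ⋂ k : ℤ, {g : Lp ℂ 2 (boundaryMeasure q) | coef (k + α) (g ∘ circ q) = (Real.exp ((k + α) * Real.log q) : ℝ) *
        coef (k + α) (g ∘ circ 1)} := by
    ext g
    simp only [SetLike.mem_coe, mem_hardySpace_iff, mem_iInter]
    rfl
  rw [this]
  exact isClosed_iInter fun k => isClosed_eq (continuous_coef_q _ _)
    (continuous_const.mul (continuous_coef_one _ _))

theorem eq_zero_of_coefs_eq_zero {q : ℝ} (hq : q ∈ Ioo (0 : ℝ) 1) (α : ℝ)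
    {g : Lp ℂ 2 (boundaryMeasure q)} (h1 : ∀ k : ℤ, coef (k + α) (g ∘ circ 1) = 0)
    (h2 : ∀ k : ℤ, coef (k + α) (g ∘ circ q) = 0) : g = 0 := by
  rw [Lp.eq_zero_iff_ae_eq_zero]
  exact (ae_boundary_iff hq).2
    ⟨ae_eq_zero_of_coef_eq_zero ((memLp_comp_one (Lp.memLp g)).integrable (by norm_num)) α h1,
    ae_eq_zero_of_coef_eq_zero ((memLp_comp_q (Lp.memLp g)).integrable (by norm_num)) α h2⟩

/-! ### The monomial basis of H²_0 and restriction to the outer circle -/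

section Monomials

variable {q : ℝ} (hq : q ∈ Ioo (0 : ℝ) 1)

/-- The function `z ↦ z ^ k` in `L²(B)`. -/
def monomial (k : ℤ) : Lp ℂ 2 (boundaryMeasure q) :=
  ((memLp_cpow hq (k : ℝ)).mono_exponent (p := 2) le_top).toLp

theorem coeFn_monomial (k : ℤ) :
    monomial hq k =ᵐ[boundaryMeasure q] fun z => z ^ (((k : ℝ) : ℂ)) := MemLp.coeFn_toLp _

theorem monomial_one (k : ℤ) : monomial hq k ∘ circ 1 =ᵐ[angle] char k := by
  filter_upwards [(quasi_one q).ae_eq_comp (coeFn_monomial hq k), ae_angle_mem] with t h ht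
  rw [h, Function.comp_apply, circ_cpow one_pos ht]
  simp

theorem monomial_q (k : ℤ) : monomial hq k ∘ circ q =ᵐ[angle]
    fun t => (Real.exp (k * Real.log q) : ℝ) * char k t := by
  filter_upwards [(quasi_q q).ae_eq_comp (coeFn_monomial hq k), ae_angle_mem] with t h ht
  rw [h, Function.comp_apply, circ_cpow hq.1 ht]

theorem coef_monomial_one_self (k : ℤ) : coef k (monomial hq k ∘ circ 1) = 2 * Real.pi := by
  rw [coef_congr (monomial_one hq k), coef_char_self]

theorem coef_monomial_q_self (k : ℤ) :
    coef k (monomial hq k ∘ circ q) = (Real.exp (k * Real.log q) : ℝ) * (2 * Real.pi) := by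
  rw [coef_congr (monomial_q hq k), coef_const_mul, coef_char_self]

theorem coef_monomial_one_ne {j k : ℤ} (h : j ≠ k) : coef j (monomial hq k ∘ circ 1) = 0 := by
  rw [coef_congr (monomial_one hq k)]
  simpa using coef_char_ne h 0

theorem coef_monomial_q_ne {j k : ℤ} (h : j ≠ k) : coef j (monomial hq k ∘ circ q) = 0 := by
  rw [coef_congr (monomial_q hq k), coef_const_mul]
  have := coef_char_ne h 0
  simp only [add_zero] at this
  rw [this, mul_zero]

theorem monomial_mem (k : ℤ) : monomial hq k ∈ hardySpace hq 0 := by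
  rw [mem_hardySpace_iff]
  intro j
  simp only [add_zero]
  by_cases h : j = k
  · subst h; rw [coef_monomial_one_self, coef_monomial_q_self]
  · rw [coef_monomial_one_ne hq h, coef_monomial_q_ne hq h, mul_zero]

theorem inner_monomial (k : ℤ) (g : Lp ℂ 2 (boundaryMeasure q)) :
    inner ℂ (monomial hq k) g =
      coef k (g ∘ circ 1) + (Real.exp (k * Real.log q) : ℝ) * coef k (g ∘ circ q) := by
  rw [inner_L2, integral_boundary (integrable_conj_mul _ _), ← coef_const_mul]
  congr 1
  · refine integral_congr_ae ?_
    filter_upwards [monomial_one hq k] with t h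
    rw [Function.comp_apply] at h
    rw [h, char_neg, Function.comp_apply, mul_comm]
  · refine integral_congr_ae ?_
    filter_upwards [monomial_q hq k] with t h
    rw [Function.comp_apply] at h
    rw [h, char_neg, Function.comp_apply, map_mul, Complex.conj_ofReal]; ring

theorem norm_sq_monomial (k : ℤ) :
    ‖monomial hq k‖ ^ 2 = 2 * Real.pi * (1 + Real.exp (k * Real.log q) ^ 2) := by
  have h := inner_monomial hq k (monomial hq k)
  rw [inner_self_eq_norm_sq_to_K, coef_monomial_one_self, coef_monomial_q_self] at h
  have h' : ((‖monomial hq k‖ ^ 2 : ℝ) : ℂ) =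
      ((2 * Real.pi * (1 + Real.exp (k * Real.log q) ^ 2) : ℝ) : ℂ) := by
    have e : ((‖monomial hq k‖ ^ 2 : ℝ) : ℂ) = (RCLike.ofReal ‖monomial hq k‖ : ℂ) ^ 2 := by
      push_cast; rfl
    rw [e, h]; push_cast; ring
  exact_mod_cast h'

theorem inner_monomial_ne {j k : ℤ} (h : j ≠ k) :
    inner ℂ (monomial hq j) (monomial hq k) = 0 := by
  rw [inner_monomial, coef_monomial_one_ne hq h, coef_monomial_q_ne hq h]; simp

theorem monomial_norm_pos (k : ℤ) : 0 < ‖monomial hq k‖ := by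
  have := norm_sq_monomial hq k
  have h2 : 0 < ‖monomial hq k‖ ^ 2 := by rw [this]; have := Real.pi_pos; positivity
  exact lt_of_le_of_ne (norm_nonneg _) fun h => by rw [← h] at h2; simp at h2

/-- The normalized monomials, as elements of the single valued Hardy space. -/
def unitMonomial (k : ℤ) : hardySpace hq 0 :=
  ((‖monomial hq k‖⁻¹ : ℝ) : ℂ) • ⟨monomial hq k, monomial_mem hq k⟩

theorem coe_unitMonomial (k : ℤ) : (unitMonomial hq k : Lp ℂ 2 (boundaryMeasure q)) =
    ((‖monomial hq k‖⁻¹ : ℝ) : ℂ) • monomial hq k := rfl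

theorem orthonormal_unitMonomial : Orthonormal ℂ (unitMonomial hq) := by
  refine ⟨fun k => ?_, fun j k hjk => ?_⟩
  · change ‖(unitMonomial hq k : Lp ℂ 2 (boundaryMeasure q))‖ = 1
    rw [coe_unitMonomial, norm_smul, Complex.norm_real, norm_inv, norm_norm,
      inv_mul_cancel₀ (monomial_norm_pos hq k).ne']
  · show inner ℂ (unitMonomial hq j : Lp ℂ 2 (boundaryMeasure q)) (unitMonomial hq k) = 0
    rw [coe_unitMonomial, coe_unitMonomial, inner_smul_left, inner_smul_right,
      inner_monomial_ne hq hjk]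
    simp

instance : CompleteSpace (hardySpace hq 0) := (isClosed_hardySpace hq 0).completeSpace_coe

theorem hasSum_unitMonomial (f : hardySpace hq 0) :
    HasSum (fun k => inner ℂ (unitMonomial hq k : Lp ℂ 2 (boundaryMeasure q)) f •
      (unitMonomial hq k : Lp ℂ 2 (boundaryMeasure q))) (f : Lp ℂ 2 (boundaryMeasure q)) := by
  -- For g in H²_0, the inner product with z^k is (1 + q^{2k}) times the outer coefficient, so
  -- orthogonality to every monomial kills all coefficients.
  have hbot : (Submodule.span ℂ (range (unitMonomial hq)))ᗮ = ⊥ := by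
    rw [Submodule.eq_bot_iff]
    intro g hg
    have hg' : ∀ k, inner ℂ (monomial hq k) (g : Lp ℂ 2 (boundaryMeasure q)) = 0 := fun k => by
      have h1 := hg _ (Submodule.subset_span ⟨k, rfl⟩)
      change inner ℂ (unitMonomial hq k : Lp ℂ 2 (boundaryMeasure q)) g = 0 at h1
      rw [coe_unitMonomial, inner_smul_left] at h1
      simpa [(monomial_norm_pos hq k).ne', norm_ne_zero_iff.1 (monomial_norm_pos hq k).ne'] using h1
    have hrel := (mem_hardySpace_iff hq).1 g.2
    have h0 : ∀ k : ℤ, coef (k + 0) ((g : Lp ℂ 2 (boundaryMeasure q)) ∘ circ 1) = 0 := fun k => by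
      have h1 := hg' k
      have h2 := hrel k
      simp only [add_zero] at h2 ⊢
      rw [inner_monomial, h2, ← mul_assoc, ← one_add_mul, mul_eq_zero] at h1
      refine h1.resolve_left ?_
      norm_cast
      positivity
    refine Subtype.ext (eq_zero_of_coefs_eq_zero hq 0 h0 fun k => ?_)
    rw [hrel k, h0 k, mul_zero]
  have h := (HilbertBasis.mkOfOrthogonalEqBot (orthonormal_unitMonomial hq) hbot).hasSum_repr f
  have h2 := h.mapL (hardySpace hq 0).subtypeL
  simpa [HilbertBasis.repr_apply_apply] using h2

/-- The indicator function of the unit circle. -/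
def outerInd (z : ℂ) : ℂ := by classical exact if ‖z‖ = 1 then 1 else 0

theorem outerInd_one (t : ℝ) : outerInd (circ 1 t) = 1 := by
  simp [outerInd, norm_circ zero_le_one]

theorem outerInd_q {q : ℝ} (hq : q ∈ Ioo (0 : ℝ) 1) (t : ℝ) : outerInd (circ q t) = 0 := by
  simp [outerInd, norm_circ hq.1.le, hq.2.ne]

theorem memLp_outerInd {q : ℝ} (hq : q ∈ Ioo (0 : ℝ) 1) : MemLp outerInd ∞ (boundaryMeasure q) := by
  classical
  refine memLp_top_of_bounds (C := 1) hq (Measurable.aestronglyMeasurable ?_)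
    (Eventually.of_forall fun t => by simp [outerInd_one])
    (Eventually.of_forall fun t => by simp [outerInd_q hq])
  unfold outerInd
  exact Measurable.ite (measurableSet_eq_fun measurable_norm measurable_const) measurable_const
    measurable_const

/-- Restriction to the outer boundary circle. -/
def outerProj : Lp ℂ 2 (boundaryMeasure q) →L[ℂ] Lp ℂ 2 (boundaryMeasure q) :=
  mulOp (memLp_outerInd hq)

theorem outerProj_one (f : Lp ℂ 2 (boundaryMeasure q)) :
    outerProj hq f ∘ circ 1 =ᵐ[angle] f ∘ circ 1 := by
  filter_upwards [(quasi_one q).ae_eq_comp (coeFn_mulOp (memLp_outerInd hq) f)] with t h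
  simpa [outerInd_one, outerProj] using h

theorem outerProj_q (f : Lp ℂ 2 (boundaryMeasure q)) :
    outerProj hq f ∘ circ q =ᵐ[angle] fun _ => 0 := by
  filter_upwards [(quasi_q q).ae_eq_comp (coeFn_mulOp (memLp_outerInd hq) f)] with t h
  simpa [outerInd_q hq, outerProj] using h

theorem mulOp_comm {X : Type*} [MeasurableSpace X] {μ : Measure X} {m n : X → ℂ}
    (hm : MemLp m ∞ μ) (hn : MemLp n ∞ μ) (f : Lp ℂ 2 μ) :
    mulOp hm (mulOp hn f) = mulOp hn (mulOp hm f) := by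
  ext1
  filter_upwards [coeFn_mulOp hm (mulOp hn f), coeFn_mulOp hn (mulOp hm f), coeFn_mulOp hm f,
    coeFn_mulOp hn f] with z h1 h2 h3 h4
  rw [h1, h2, h3, h4]; ring

theorem outerProj_idem : outerProj hq * outerProj hq = outerProj hq := by
  ext1 f
  ext1
  filter_upwards [coeFn_mulOp (memLp_outerInd hq) (outerProj hq f),
    coeFn_mulOp (memLp_outerInd hq) f] with z h1 h2
  have h : outerInd z * outerInd z = outerInd z := by unfold outerInd; split_ifs <;> simp
  change mulOp (memLp_outerInd hq) (outerProj hq f) z = mulOp (memLp_outerInd hq) f z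
  rw [h1]
  change _ * mulOp (memLp_outerInd hq) f z = _
  rw [h2, ← mul_assoc, h]

theorem isSelfAdjoint_outerProj : IsSelfAdjoint (outerProj hq) := by
  rw [ContinuousLinearMap.isSelfAdjoint_iff_isSymmetric]
  intro f g
  change inner ℂ (outerProj hq f) g = inner ℂ f (outerProj hq g)
  rw [inner_L2, inner_L2]
  refine integral_congr_ae ?_
  filter_upwards [coeFn_mulOp (memLp_outerInd hq) f, coeFn_mulOp (memLp_outerInd hq) g]
    with z h1 h2
  have h : (starRingEnd ℂ) (outerInd z) = outerInd z := by unfold outerInd; split_ifs <;> simp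
  change (starRingEnd ℂ) (mulOp (memLp_outerInd hq) f z) * _ =
    _ * mulOp (memLp_outerInd hq) g z
  rw [h1, h2, map_mul, h]; ring

theorem outerProj_apply_self (f : Lp ℂ 2 (boundaryMeasure q)) :
    outerProj hq (outerProj hq f) = outerProj hq f := congr($(outerProj_idem hq) f)

theorem inner_outerProj_left (f g : Lp ℂ 2 (boundaryMeasure q)) :
    inner ℂ (outerProj hq f) g = inner ℂ f (outerProj hq g) :=
  (isSelfAdjoint_outerProj hq).isSymmetric f g

theorem coef_outerProj_one (b : ℝ) (f : Lp ℂ 2 (boundaryMeasure q)) :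
    coef b (outerProj hq f ∘ circ 1) = coef b (f ∘ circ 1) := coef_congr (outerProj_one hq f) b

theorem coef_outerProj_q (b : ℝ) (f : Lp ℂ 2 (boundaryMeasure q)) :
    coef b (outerProj hq f ∘ circ q) = 0 := by
  rw [coef_congr (outerProj_q hq f)]; simp [coef]

theorem norm_outerProj_monomial_sq (k : ℤ) : ‖outerProj hq (monomial hq k)‖ ^ 2 = 2 * Real.pi := by
  have h := inner_outerProj_left hq (monomial hq k) (outerProj hq (monomial hq k))
  rw [outerProj_apply_self, inner_monomial, coef_outerProj_one, coef_outerProj_q,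
    coef_monomial_one_self, inner_self_eq_norm_sq_to_K] at h
  have h' : ((‖outerProj hq (monomial hq k)‖ ^ 2 : ℝ) : ℂ) = ((2 * Real.pi : ℝ) : ℂ) := by
    have e : ((‖outerProj hq (monomial hq k)‖ ^ 2 : ℝ) : ℂ) =
      (RCLike.ofReal ‖outerProj hq (monomial hq k)‖ : ℂ) ^ 2 := by push_cast; rfl
    rw [e, h]; push_cast; ring
  exact_mod_cast h'

theorem norm_sub_outerProj_monomial_sq (k : ℤ) :
    ‖monomial hq k - outerProj hq (monomial hq k)‖ ^ 2 =
      2 * Real.pi * Real.exp (k * Real.log q) ^ 2 := by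
  have h : inner ℂ (monomial hq k - outerProj hq (monomial hq k)) (outerProj hq (monomial hq k)) = 0 := by
    rw [inner_sub_left, inner_outerProj_left, outerProj_apply_self, sub_self]
  have h2 := norm_add_sq_eq_norm_sq_add_norm_sq_of_inner_eq_zero (𝕜 := ℂ) _ _ h
  rw [sub_add_cancel] at h2
  have h3 := norm_sq_monomial hq k
  have h4 := norm_outerProj_monomial_sq hq k
  nlinarith

/-- The exact value is (1 + q^{2k})^{-1/2}, at most q^{-k}: normalized monomials with k → -∞
concentrate on the inner circle. The next lemma is the counterpart for k → +∞. -/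
theorem norm_outerProj_unitMonomial_le (k : ℤ) :
    ‖outerProj hq (unitMonomial hq k : Lp ℂ 2 (boundaryMeasure q))‖ ≤
      Real.exp (-(k * Real.log q)) := by
  have h0 := monomial_norm_pos hq k
  rw [coe_unitMonomial, map_smul, norm_smul, Complex.norm_real, norm_inv, norm_norm,
    inv_mul_le_iff₀ h0]
  have h1 := norm_sq_monomial hq k
  have h2 := norm_outerProj_monomial_sq hq k
  have hπ := Real.pi_pos
  have hx : Real.exp (k * Real.log q) * Real.exp (-(k * Real.log q)) = 1 := by
    rw [← Real.exp_add]; simp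
  refine le_of_sq_le_sq ?_ (by positivity)
  rw [mul_pow, h1, h2]
  have h5 : Real.exp (k * Real.log q) ^ 2 * Real.exp (-(k * Real.log q)) ^ 2 = 1 := by
    rw [← mul_pow, hx, one_pow]
  nlinarith [sq_nonneg (Real.exp (-(k * Real.log q)))]

theorem norm_sub_outerProj_unitMonomial_le (k : ℤ) :
    ‖(unitMonomial hq k : Lp ℂ 2 (boundaryMeasure q)) -
      outerProj hq (unitMonomial hq k : Lp ℂ 2 (boundaryMeasure q))‖ ≤
      Real.exp (k * Real.log q) := by
  have h0 := monomial_norm_pos hq k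
  rw [coe_unitMonomial, map_smul, ← smul_sub, norm_smul, Complex.norm_real, norm_inv, norm_norm,
    inv_mul_le_iff₀ h0]
  have h1 := norm_sq_monomial hq k
  have h2 := norm_sub_outerProj_monomial_sq hq k
  have hπ := Real.pi_pos
  refine le_of_sq_le_sq ?_ (by positivity)
  rw [mul_pow, h1, h2]
  nlinarith [sq_nonneg (Real.exp (k * Real.log q)), sq_nonneg (Real.exp (k * Real.log q) ^ 2),
    mul_nonneg hπ.le (sq_nonneg (Real.exp (k * Real.log q) ^ 2))]

end Monomials

/-! ### Existence of eigenfunctions for a separated symbol -/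

theorem summable_norm_of_bounds {q C : ℝ} (hq : q ∈ Ioo (0 : ℝ) 1) {u : ℤ → ℝ} (hu : ∀ k, 0 ≤ u k)
    (h1 : ∀ k, u k ≤ C * Real.exp (k * Real.log q))
    (h2 : ∀ k, u k ≤ C * Real.exp (-(k * Real.log q))) : Summable u := by
  have hl := Real.log_neg hq.1 hq.2
  refine ((summable_exp_neg_abs (neg_pos.2 hl) 0).mul_left C).of_nonneg_of_le hu fun k => ?_
  rcases le_total (0 : ℝ) k with hk | hk
  · convert h1 k using 3
    rw [add_zero, abs_of_nonneg hk]; ring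
  · convert h2 k using 3
    rw [add_zero, abs_of_nonpos hk]; ring

/-- For a weight `w = s²` bounded above and below there is a nonzero `f ∈ H²` for which the forms
`∫_{B₁} w f h̄` and `∫_{B_q} w f h̄` are proportional, with a positive factor. -/
theorem exists_weighted_eigenvector {q : ℝ} (hq : q ∈ Ioo (0 : ℝ) 1) {s s' : ℂ → ℂ}
    (hs : MemLp s ∞ (boundaryMeasure q)) (hs' : MemLp s' ∞ (boundaryMeasure q))
    (hss : ∀ᵐ z ∂boundaryMeasure q, s z * s' z = 1) :
    ∃ μ ∈ Ioo (0 : ℝ) 1, ∃ f ∈ hardySpace hq 0, f ≠ 0 ∧ ∀ h ∈ hardySpace hq 0,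
      inner ℂ (mulOp hs h) (mulOp hs (outerProj hq f - (μ : ℂ) • f)) = 0 := by
  set S := mulOp hs with hS
  set S' := mulOp hs' with hS'
  set E := outerProj hq with hE
  have hSS' : ∀ f, S (S' f) = f := fun f => by
    ext1
    filter_upwards [coeFn_mulOp hs (S' f), coeFn_mulOp hs' f, hss] with z h1 h2 h3
    rw [h1, h2, ← mul_assoc, h3, one_mul]
  have hS'S : ∀ f, S' (S f) = f := fun f => by
    ext1
    filter_upwards [coeFn_mulOp hs' (S f), coeFn_mulOp hs f, hss] with z h1 h2 h3
    rw [h1, h2, ← mul_assoc, mul_comm (s' z), h3, one_mul]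
  have hES : ∀ f, E (S f) = S (E f) := fun f => mulOp_comm _ _ f
  -- H' is S H²_0. Carrying the weight into the space turns the weighted problem into one about the
  -- orthogonal projections P onto H' and E onto the outer circle.
  set H' : Submodule ℂ (Lp ℂ 2 (boundaryMeasure q)) :=
    (hardySpace hq 0).comap (S' : Lp ℂ 2 (boundaryMeasure q) →ₗ[ℂ] Lp ℂ 2 (boundaryMeasure q)) with hH'
  have hmem : ∀ f, f ∈ hardySpace hq 0 → S f ∈ H' := fun f hf => by
    show S' (S f) ∈ hardySpace hq 0
    rwa [hS'S]
  have hcl : IsClosed (H' : Set (Lp ℂ 2 (boundaryMeasure q))) :=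
    (isClosed_hardySpace hq 0).preimage S'.continuous
  have : CompleteSpace H' := hcl.completeSpace_coe
  set P := H'.starProjection with hP
  have hPmem : ∀ v, P v ∈ H' := fun v => H'.starProjection_apply_mem v
  have hPself : ∀ v ∈ H', P v = v := fun v hv => Submodule.starProjection_eq_self_iff.2 hv
  let u : ℤ → Lp ℂ 2 (boundaryMeasure q) := fun k => unitMonomial hq k
  let Y : Lp ℂ 2 (boundaryMeasure q) →L[ℂ] Lp ℂ 2 (boundaryMeasure q) := (1 - P) * E * S
  -- As S f lies in H', 1 - P kills it, so Y f can be computed from the outer or from the inner part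
  -- of f. On the k-th basis vector the smaller part is O(q^{|k|}), which makes the series for (1 -
  -- P)EP absolutely summable.
  have hY : ∀ f ∈ hardySpace hq 0, Y f = (1 - P) (S (E f)) ∧ Y f = -(1 - P) (S (f - E f)) := by
    intro f hf
    have h1 : Y f = (1 - P) (S (E f)) := by rw [← hES]; rfl
    refine ⟨h1, ?_⟩
    have h2 : (1 - P) (S f) = 0 := by
      show S f - P (S f) = 0
      rw [hPself _ (hmem f hf), sub_self]
    rw [h1, map_sub, map_sub, h2, zero_sub, neg_neg]
  have hcomp : IsCompactOperator ((1 - P) * E * P : Lp ℂ 2 (boundaryMeasure q) →L[ℂ] _) := by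
    refine isCompactOperator_of_hasSum (ι := ℤ) (φ := fun k => (innerSL ℂ (u k)) ∘L (S' * P))
      (y := fun k => Y (u k)) ?_ fun v => ?_
    · have hφ : ∀ k, ‖(innerSL ℂ (u k)) ∘L (S' * P)‖ ≤ ‖S' * P‖ := fun k => by
        refine (ContinuousLinearMap.opNorm_comp_le _ _).trans ?_
        have h1 : ‖u k‖ = 1 := (orthonormal_unitMonomial hq).1 k
        rw [innerSL_apply_norm, h1, one_mul]
      refine summable_norm_of_bounds (C := ‖S' * P‖ * (‖(1 - P) * S‖)) hq
        (fun k => by positivity) (fun k => ?_) fun k => ?_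
      · rw [mul_assoc]
        refine mul_le_mul (hφ k) ?_ (norm_nonneg _) (norm_nonneg _)
        rw [(hY _ (unitMonomial hq k).2).2, norm_neg]
        refine (((1 - P) * S).le_opNorm _).trans ?_
        exact mul_le_mul_of_nonneg_left (norm_sub_outerProj_unitMonomial_le hq k) (norm_nonneg _)
      · rw [mul_assoc]
        refine mul_le_mul (hφ k) ?_ (norm_nonneg _) (norm_nonneg _)
        rw [(hY _ (unitMonomial hq k).2).1]
        refine (((1 - P) * S).le_opNorm _).trans ?_
        exact mul_le_mul_of_nonneg_left (norm_outerProj_unitMonomial_le hq k) (norm_nonneg _)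
    · have h1 := (hasSum_unitMonomial hq ⟨S' (P v), hPmem v⟩).mapL Y
      have h2 : Y (S' (P v)) = ((1 - P) * E * P) v := by
        show ((1 - P) * E) (S (S' (P v))) = _
        rw [hSS']; rfl
      simp only [map_smul] at h1
      rw [h2] at h1
      exact h1
  -- Otherwise the restriction of the constant 1 to the outer circle, extended by 0, would be in
  -- H²_0, against `CoefRel` at frequency 0.
  have hne : (1 - P) * E * P ≠ 0 := by
    intro h0
    have h1 : S (monomial hq 0) ∈ H' := hmem _ (monomial_mem hq 0)
    have h2 : ((1 - P) * E * P) (S (monomial hq 0)) = 0 := by rw [h0]; rfl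
    have h3 : S (E (monomial hq 0)) - P (S (E (monomial hq 0))) = 0 := by
      rw [← h2, ← hES]
      show _ = E (P _) - P (E (P _))
      rw [hPself _ h1]
    have h4 : S (E (monomial hq 0)) ∈ H' := by
      rw [sub_eq_zero.1 h3]; exact hPmem _
    have h5 : E (monomial hq 0) ∈ hardySpace hq 0 := by
      have : S' (S (E (monomial hq 0))) ∈ hardySpace hq 0 := h4
      rwa [hS'S] at this
    have h6 := (mem_hardySpace_iff hq).1 h5 0
    rw [add_zero, coef_outerProj_q, coef_outerProj_one, coef_monomial_one_self] at h6
    have := Real.pi_ne_zero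
    simp [this] at h6
  obtain ⟨μ, hμ, v, hv0, hPv, hPE⟩ := exists_eigenvector_compression
    (isSelfAdjoint_starProjection H') H'.isIdempotentElem_starProjection
    (isSelfAdjoint_outerProj hq) (outerProj_idem hq) hcomp hne
  have hvH : v ∈ H' := by rw [← hPv]; exact hPmem v
  refine ⟨μ, hμ, S' v, hvH, fun h => hv0 ?_, fun h hh => ?_⟩
  · rw [← hSS' v, h, map_zero]
  · have h1 : S (E (S' v) - (μ : ℂ) • S' v) = E v - P (E v) := by
      rw [map_sub, map_smul, ← hES, hSS', hPE]
    rw [h1]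
    exact H'.inner_right_of_mem_orthogonal (hmem h hh) (H'.sub_starProjection_mem_orthogonal _)

/-- If a real symbol is separated from `l` with opposite signs on the two boundary circles, then `l`
is an eigenvalue. -/
theorem mem_relativeEigenvalues_of_separated {q : ℝ} (hq : q ∈ Ioo (0 : ℝ) 1)
    (φ : Lp ℝ ∞ (boundaryMeasure q)) {l δ ε : ℝ} (hδ : 0 < δ) (hε : ε ^ 2 = 1)
    (h1 : ∀ᵐ t ∂angle, δ ≤ ε * (φ (circ 1 t) - l))
    (h2 : ∀ᵐ t ∂angle, δ ≤ -(ε * (φ (circ q t) - l))) :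
    (l : ℂ) ∈ relativeEigenvalues hq φ := by
  have hε0 : ε ≠ 0 := by rintro rfl; norm_num at hε
  have hεa : |ε| = 1 := by
    have : |ε| ^ 2 = 1 := by rw [sq_abs, hε]
    exact (pow_eq_one_iff_of_nonneg (abs_nonneg _) two_ne_zero).1 this
  let w : ℂ → ℝ := fun z => |φ z - l|
  have hδw : ∀ᵐ z ∂boundaryMeasure q, δ ≤ w z := by
    refine (ae_boundary_iff hq).2 ⟨?_, ?_⟩
    · filter_upwards [h1] with t ht
      have := ht.trans (le_abs_self _)
      rwa [abs_mul, hεa, one_mul] at this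
    · filter_upwards [h2] with t ht
      have := ht.trans (le_abs_self _)
      rwa [abs_neg, abs_mul, hεa, one_mul] at this
  have hφm : AEStronglyMeasurable w (boundaryMeasure q) :=
    ((Lp.aestronglyMeasurable φ).sub aestronglyMeasurable_const).norm
  have hwb : MemLp w ∞ (boundaryMeasure q) :=
    ((Lp.memLp φ).sub (memLp_top_const l)).norm
  obtain ⟨C, hC⟩ : ∃ C : ℝ, ∀ᵐ z ∂boundaryMeasure q, w z ≤ C := by
    refine ⟨(eLpNorm w ∞ (boundaryMeasure q)).toReal, ?_⟩
    filter_upwards [ae_le_eLpNormEssSup (f := w) (μ := boundaryMeasure q)] with z hz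
    rw [← eLpNorm_exponent_top] at hz
    have := ENNReal.toReal_mono hwb.2.ne hz
    simpa [w] using this
  let s : ℂ → ℂ := fun z => (Real.sqrt (w z) : ℝ)
  let s' : ℂ → ℂ := fun z => ((Real.sqrt (w z))⁻¹ : ℝ)
  have hsm : AEStronglyMeasurable s (boundaryMeasure q) :=
    Complex.continuous_ofReal.comp_aestronglyMeasurable
      (Real.continuous_sqrt.comp_aestronglyMeasurable hφm)
  have hsm' : AEStronglyMeasurable s' (boundaryMeasure q) :=
    Complex.continuous_ofReal.comp_aestronglyMeasurable
      (Real.continuous_sqrt.comp_aestronglyMeasurable hφm).inv₀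
  have hs : MemLp s ∞ (boundaryMeasure q) := by
    refine memLp_top_of_bound hsm (Real.sqrt C) ?_
    filter_upwards [hC] with z hz
    rw [Complex.norm_real, Real.norm_of_nonneg (Real.sqrt_nonneg _)]
    exact Real.sqrt_le_sqrt hz
  have hs' : MemLp s' ∞ (boundaryMeasure q) := by
    refine memLp_top_of_bound hsm' (Real.sqrt δ)⁻¹ ?_
    filter_upwards [hδw] with z hz
    rw [Complex.norm_real, Real.norm_of_nonneg (by positivity)]
    exact inv_anti₀ (Real.sqrt_pos.2 hδ) (Real.sqrt_le_sqrt hz)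
  have hss : ∀ᵐ z ∂boundaryMeasure q, s z * s' z = 1 := by
    filter_upwards [hδw] with z hz
    simp only [s, s']
    rw [← Complex.ofReal_mul, mul_inv_cancel₀ (Real.sqrt_pos.2 (hδ.trans_le hz)).ne',
      Complex.ofReal_one]
  obtain ⟨μ, ⟨hμ0, hμ1⟩, f, hf, hf0, hfh⟩ := exists_weighted_eigenvector hq hs hs' hss
  have hlog := Real.log_neg hq.1 hq.2
  have h1μ : 0 < 1 - μ := by linarith
  -- Chosen so that q^{2α} = μ/(1 - μ). It may be any real number; its fractional part is the
  -- required index, as integer shifts leave the Hardy space unchanged.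
  let α : ℝ := Real.log (μ / (1 - μ)) / (2 * Real.log q)
  have hα : Real.exp (α * Real.log q) ^ 2 = μ / (1 - μ) := by
    rw [← Real.exp_nat_mul, ← Real.exp_log (div_pos hμ0 h1μ)]
    congr 1
    have hl0 : Real.log q ≠ 0 := hlog.ne
    simp only [α]
    push_cast
    field_simp
  let M := mulOp (memLp_cpow hq α)
  let M' := mulOp (memLp_cpow hq (-α))
  have hMM' : ∀ h, M (M' h) = h := fun h => by
    ext1
    have hz0 : ∀ᵐ z ∂boundaryMeasure q, z ≠ 0 := by
      refine (ae_boundary_iff hq).2 ⟨Eventually.of_forall fun t => ?_, Eventually.of_forall fun t => ?_⟩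
      · rw [← norm_ne_zero_iff, norm_circ zero_le_one]; exact one_ne_zero
      · rw [← norm_ne_zero_iff, norm_circ hq.1.le]; exact hq.1.ne'
    filter_upwards [coeFn_mulOp (memLp_cpow hq α) (M' h), coeFn_mulOp (memLp_cpow hq (-α)) h, hz0]
      with z e1 e2 e3
    rw [e1, e2, ← mul_assoc, ← Complex.cpow_add _ _ e3]
    simp
  have hM'M : ∀ h, M' (M h) = h := fun h => by
    have := mulOp_comm (memLp_cpow hq (-α)) (memLp_cpow hq α) h
    exact this.trans (hMM' h)
  have hfr : hardySpace hq (Int.fract α) = hardySpace hq α := by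
    conv_rhs => rw [← Int.fract_add_floor α]
    rw [hardySpace_add_int]
  have hMf : M f ∈ hardySpace hq (Int.fract α) := by
    rw [hfr]
    simpa using mulOp_cpow_mem hq hf α
  refine ⟨Int.fract α, ⟨Int.fract_nonneg α, Int.fract_lt_one α⟩, ⟨M f, hMf⟩, ?_, ?_⟩
  · intro h
    apply hf0
    have : M f = 0 := congrArg Subtype.val h
    rw [← hM'M f, this, map_zero]
  rw [toeplitz_eq_smul_iff]
  intro h hh
  rw [hfr] at hh
  have hk : M' h ∈ hardySpace hq 0 := by
    simpa [M'] using mulOp_cpow_mem hq hh (-α)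
  have key := hfh _ hk
  rw [inner_L2] at key
  have hscal : (fun z => (starRingEnd ℂ) (h z) * ((φ z - (l : ℂ)) * M f z)) =ᵐ[boundaryMeasure q]
      fun z => ((ε / (1 - μ) : ℝ) : ℂ) * ((starRingEnd ℂ) (mulOp hs (M' h) z) *
        mulOp hs (outerProj hq f - (μ : ℂ) • f) z) := by
    have ea : h =ᵐ[boundaryMeasure q] fun z => z ^ (α : ℂ) * M' h z := by
      conv_lhs => rw [← hMM' h]
      exact coeFn_mulOp _ _
    have eb : (fun z => (starRingEnd ℂ) (h z) * ((φ z - (l : ℂ)) * M f z)) =ᵐ[boundaryMeasure q]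
        fun z => ((‖z ^ (α : ℂ)‖ ^ 2 * (φ z - l) : ℝ) : ℂ) * ((starRingEnd ℂ) (M' h z) * f z) := by
      filter_upwards [ea, coeFn_mulOp (memLp_cpow hq α) f] with z e1 e2
      rw [e1, e2, map_mul]
      push_cast
      rw [← Complex.conj_mul']
      ring
    have ec : (fun z => ((ε / (1 - μ) : ℝ) : ℂ) * ((starRingEnd ℂ) (mulOp hs (M' h) z) *
        mulOp hs (outerProj hq f - (μ : ℂ) • f) z)) =ᵐ[boundaryMeasure q]
        fun z => (((ε / (1 - μ) * w z : ℝ) : ℂ) * (outerInd z - μ)) *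
          ((starRingEnd ℂ) (M' h z) * f z) := by
      filter_upwards [coeFn_mulOp hs (M' h), coeFn_mulOp hs (outerProj hq f - (μ : ℂ) • f),
        Lp.coeFn_sub (outerProj hq f) ((μ : ℂ) • f), Lp.coeFn_smul (μ : ℂ) f,
        coeFn_mulOp (memLp_outerInd hq) f] with z e1 e2 e3 e4 e5
      have e6 : outerProj hq f z = outerInd z * f z := e5
      rw [e1, e2, e3, Pi.sub_apply, e4, Pi.smul_apply, e6, map_mul]
      simp only [s, Complex.conj_ofReal, smul_eq_mul]
      have : ((w z : ℝ) : ℂ) = (Real.sqrt (w z) : ℝ) * (Real.sqrt (w z) : ℝ) := by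
        rw [← Complex.ofReal_mul, Real.mul_self_sqrt (abs_nonneg _)]
      push_cast [this]
      ring
    refine eb.trans (EventuallyEq.trans ?_ ec.symm)
    -- On B₁, φ - l = εw, |z^α| = 1 and the indicator is 1; on B_q, φ - l = -εw, |z^α|² = μ/(1 - μ)
    -- and the indicator is 0. Both sides are therefore εw on B₁ and -εwμ/(1 - μ) on B_q.
    have ed : ∀ᵐ z ∂boundaryMeasure q, ((‖z ^ (α : ℂ)‖ ^ 2 * (φ z - l) : ℝ) : ℂ) =
        ((ε / (1 - μ) * w z : ℝ) : ℂ) * (outerInd z - μ) := by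
      refine (ae_boundary_iff hq).2 ⟨?_, ?_⟩
      · filter_upwards [h1, ae_angle_mem] with t ht ht'
        rw [circ_cpow one_pos ht', outerInd_one]
        have e1 : w (circ 1 t) = ε * (φ (circ 1 t) - l) := by
          have := abs_of_pos (hδ.trans_le ht)
          rwa [abs_mul, hεa, one_mul] at this
        rw [e1]
        have e2 : φ (circ 1 t) - l = ε / (1 - μ) * (ε * (φ (circ 1 t) - l)) * (1 - μ) := by
          field_simp; rw [hε]; ring
        have e3 : ‖((Real.exp (α * Real.log 1) : ℝ) : ℂ) * char α t‖ = 1 := by simp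
        rw [e3, one_pow, one_mul]
        conv_lhs => rw [e2]
        push_cast; ring
      · filter_upwards [h2, ae_angle_mem] with t ht ht'
        rw [circ_cpow hq.1 ht', outerInd_q hq]
        have e1 : w (circ q t) = -(ε * (φ (circ q t) - l)) := by
          have := abs_of_pos (hδ.trans_le ht)
          rwa [abs_neg, abs_mul, hεa, one_mul] at this
        have e3 : ‖((Real.exp (α * Real.log q) : ℝ) : ℂ) * char α t‖ ^ 2 = μ / (1 - μ) := by
          rw [norm_mul, norm_char, mul_one, Complex.norm_real,
            Real.norm_of_nonneg (Real.exp_pos _).le, hα]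
        have e2 : μ / (1 - μ) * (φ (circ q t) - l) =
            ε / (1 - μ) * -(ε * (φ (circ q t) - l)) * (0 - μ) := by
          field_simp; rw [hε]; ring
        rw [e1, e3, e2]
        push_cast; ring
    filter_upwards [ed] with z hz
    rw [hz]
  rw [integral_congr_ae hscal, integral_const_mul, key, mul_zero]

/-! ### Boundary uniqueness -/

theorem eq_zero_of_outer_eq_zero {q α : ℝ} (hq : q ∈ Ioo (0 : ℝ) 1)
    {g : Lp ℂ 2 (boundaryMeasure q)} (hg : g ∈ hardySpace hq α)
    (h : ∀ k : ℤ, coef (k + α) (g ∘ circ 1) = 0) : g = 0 :=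
  eq_zero_of_coefs_eq_zero hq α h fun k => by
    rw [(mem_hardySpace_iff hq).1 hg k, h, mul_zero]

theorem eq_zero_of_inner_eq_zero {q α : ℝ} (hq : q ∈ Ioo (0 : ℝ) 1)
    {g : Lp ℂ 2 (boundaryMeasure q)} (hg : g ∈ hardySpace hq α)
    (h : ∀ k : ℤ, coef (k + α) (g ∘ circ q) = 0) : g = 0 :=
  eq_zero_of_outer_eq_zero hq hg fun k => by
    have h1 := (mem_hardySpace_iff hq).1 hg k
    rw [h, eq_comm, mul_eq_zero] at h1
    exact h1.resolve_left (by exact_mod_cast (Real.exp_pos _).ne')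

theorem coef_eq_zero_of_ae {f : ℝ → ℂ} (h : ∀ᵐ t ∂angle, f t = 0) (b : ℝ) : coef b f = 0 := by
  rw [coef_congr (g := fun _ => 0) h]; simp [coef]

/-- A product of two Hardy class functions vanishing on the outer circle forces one factor to vanish. -/
theorem eq_zero_or_eq_zero_of_mul_ae_eq_zero {q α β : ℝ} (hq : q ∈ Ioo (0 : ℝ) 1)
    {g h : Lp ℂ 2 (boundaryMeasure q)} (hg : g ∈ hardySpace hq α) (hh : h ∈ hardySpace hq β)
    (hgh : ∀ᵐ t ∂angle, g (circ 1 t) * h (circ 1 t) = 0) : g = 0 ∨ h = 0 := by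
  obtain ⟨F, hF, hFg⟩ := hg
  obtain ⟨G, hG, hGh⟩ := hh
  have hlog := Real.log_neg hq.1 hq.2
  have hg1 := memLp_comp_one (Lp.memLp g)
  have hh1 := memLp_comp_one (Lp.memLp h)
  have hev : ∀ᶠ s in 𝓝[<] (0 : ℝ), s ∈ Ioo (Real.log q) 0 := Ioo_mem_nhdsLT hlog
  have hFGd : DifferentiableOn ℂ (F * G) (cover q) := hF.analytic.mul hG.analytic
  have hFGi : ∀ w ∈ cover q, (F * G) (w + 2 * Real.pi * Complex.I) =
      Complex.exp (2 * Real.pi * Complex.I * (α + β : ℝ)) * (F * G) w := fun w hw => by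
    have : Complex.exp (2 * Real.pi * Complex.I * (α + β : ℝ)) =
        Complex.exp (2 * Real.pi * Complex.I * α) * Complex.exp (2 * Real.pi * Complex.I * β) := by
      rw [← Complex.exp_add]; push_cast; ring_nf
    rw [this, Pi.mul_apply, Pi.mul_apply, hF.index w hw, hG.index w hw]; ring
  have hlim : Tendsto (fun s => eLpNorm (slice (F * G) s - fun _ => 0) 1 angle) (𝓝[<] 0) (𝓝 0) := by
    obtain ⟨C, hC⟩ := hG.bounded_means
    have h1 := (ENNReal.Tendsto.mul_const (b := (C : ℝ≥0∞)) hFg.outer_circle (Or.inr (by simp))).add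
      (ENNReal.Tendsto.const_mul (a := eLpNorm (g ∘ circ 1) 2 angle) hGh.outer_circle
        (Or.inr hg1.2.ne))
    simp only [zero_mul, mul_zero, add_zero] at h1
    refine tendsto_of_tendsto_of_tendsto_of_le_of_le' tendsto_const_nhds h1
      (Eventually.of_forall fun _ => zero_le) ?_
    filter_upwards [hev] with s hs
    have mF := memLp_slice hF.analytic hs 2
    have mG := memLp_slice hG.analytic hs 2
    -- FG = (F - g)G + g(G - h) + gh with gh = 0 on B₁; Cauchy–Schwarz then gives convergence to 0
    -- in L¹.
    have e1 : (slice (F * G) s - fun _ => 0) =ᵐ[angle]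
        (slice F s - g ∘ circ 1) • slice G s + (g ∘ circ 1) • (slice G s - h ∘ circ 1) := by
      filter_upwards [hgh] with t ht
      simp only [Pi.sub_apply, Pi.add_apply, smul_eq_mul, Function.comp_apply, slice,
        Pi.mul_apply]
      linear_combination ht
    rw [eLpNorm_congr_ae e1]
    refine (eLpNorm_add_le ((mF.sub hg1).1.smul mG.1) (hg1.1.smul (mG.sub hh1).1) le_rfl).trans ?_
    refine add_le_add ((eLpNorm_smul_le_mul_eLpNorm (p := 2) (q := 2) mG.1 (mF.sub hg1).1).trans ?_)
      (eLpNorm_smul_le_mul_eLpNorm (p := 2) (q := 2) (mG.sub hh1).1 hg1.1)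
    exact mul_le_mul_right (hC s hs) _
  -- FG has index α + β, so each coefficient is a constant times e^{(k+α+β)s}; tending to 0 as s → 0
  -- forces the constant to be 0. Hence FG vanishes, and analyticity makes one factor vanish.
  have hzero : ∀ s ∈ Ioo (Real.log q) 0, ∀ k : ℤ, coef (k + (α + β)) (slice (F * G) s) = 0 := by
    intro s hs k
    obtain ⟨A, hA⟩ := coef_slice hFGd hFGi k
    have h1 := tendsto_coef (hev.mono fun s hs => memLp_one_iff_integrable.1 (memLp_slice hFGd hs 1))
      (integrable_zero _ _ _) hlim (k + (α + β))
    have h2 : Tendsto (fun s : ℝ => ((Real.exp ((k + (α + β)) * s) : ℝ) : ℂ) * A) (𝓝[<] 0)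
        (𝓝 (((Real.exp ((k + (α + β)) * 0) : ℝ) : ℂ) * A)) :=
      (Continuous.tendsto (by fun_prop) 0).mono_left nhdsWithin_le_nhds
    have h3 := tendsto_nhds_unique (h1.congr' (hev.mono fun s hs => hA s hs)) h2
    have h4 : A = 0 := by simpa [coef] using h3.symm
    rw [hA s hs, h4, mul_zero]
  let U : Set ℂ := Ioo (Real.log q) 0 ×ℂ Ioo (-Real.pi) Real.pi
  have hU : IsOpen U := isOpen_Ioo.reProdIm isOpen_Ioo
  have hUc : U ⊆ cover q := fun w hw => hw.1
  have hUp : IsPreconnected U := (((convex_Ioo (Real.log q) 0).linear_preimage Complex.reLm).inter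
      ((convex_Ioo (-Real.pi) Real.pi).linear_preimage Complex.imLm)).isPreconnected
  have hprod : ∀ w ∈ U, F w * G w = 0 := by
    intro w hw
    have h1 := ae_eq_zero_of_coef_eq_zero
      (memLp_one_iff_integrable.1 (memLp_slice hFGd hw.1 1)) (α + β) (hzero w.re hw.1)
    have h2 : slice (F * G) w.re =ᵐ[volume.restrict (Ioo (-Real.pi) Real.pi)] 0 :=
      ae_restrict_of_ae_restrict_of_subset Ioo_subset_Ioc_self h1
    have h3 := Measure.eqOn_open_of_ae_eq h2 isOpen_Ioo (continuous_slice hFGd hw.1).continuousOn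
      continuousOn_const hw.2
    simpa [slice, Complex.re_add_im] using h3
  have hvan : ∀ {γ : ℝ} {K : ℂ → ℂ} {k : Lp ℂ 2 (boundaryMeasure q)}, IsHardy q γ K →
      HasBoundaryValue q K k → (∀ w ∈ U, K w = 0) → k = 0 := by
    intro γ K k hK hKk hz
    refine eq_zero_of_outer_eq_zero hq ⟨K, hK, hKk⟩ fun n => ?_
    obtain ⟨s, hs⟩ := exists_between hlog
    have h1 := coef_slice_eq hq hK (memLp_comp_one (Lp.memLp k)) hKk n hs
    have h2 : coef (n + γ) (slice K s) = 0 := by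
      refine coef_eq_zero_of_ae ?_ _
      have hne : ∀ᵐ t ∂(volume : Measure ℝ), t ≠ Real.pi := by simp [ae_iff]
      filter_upwards [ae_angle_mem, ae_restrict_of_ae hne] with t ht ht'
      refine hz _ ⟨by simpa using hs, ?_⟩
      simpa using ⟨ht.1, lt_of_le_of_ne ht.2 ht'⟩
    rw [h2, eq_comm, mul_eq_zero] at h1
    exact h1.resolve_left (by exact_mod_cast (Real.exp_pos _).ne')
  rcases AnalyticOnNhd.eq_zero_or_eq_zero_of_mul_eq_zero ((hF.analytic.mono hUc).analyticOnNhd hU)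
    ((hG.analytic.mono hUc).analyticOnNhd hU) hprod hUp with h1 | h1
  · exact Or.inl (hvan hF hFg h1)
  · exact Or.inr (hvan hG hGh h1)

/-! ### What the eigenvalue equation says about the symbol -/

instance : NeZero angle := ⟨by
  simp [angle, Measure.restrict_eq_zero, Real.pi_pos]⟩

theorem exists_bound {q : ℝ} (φ : Lp ℝ ∞ (boundaryMeasure q)) :
    ∃ C : ℝ, ∀ᵐ z ∂boundaryMeasure q, |φ z| ≤ C := by
  refine ⟨(eLpNorm φ ∞ (boundaryMeasure q)).toReal, ?_⟩
  filter_upwards [ae_le_eLpNormEssSup (f := φ) (μ := boundaryMeasure q)] with z hz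
  rw [← eLpNorm_exponent_top] at hz
  simpa using ENNReal.toReal_mono (Lp.memLp φ).2.ne hz

theorem integrable_norm_sq {q : ℝ} (g : Lp ℂ 2 (boundaryMeasure q)) :
    Integrable (fun z => ‖g z‖ ^ 2) (boundaryMeasure q) :=
  (memLp_two_iff_integrable_sq_norm (Lp.memLp g).1).1 (Lp.memLp g)

theorem integrable_mul_norm_sq {q : ℝ} (φ : Lp ℝ ∞ (boundaryMeasure q))
    (g : Lp ℂ 2 (boundaryMeasure q)) :
    Integrable (fun z => φ z * ‖g z‖ ^ 2) (boundaryMeasure q) := by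
  obtain ⟨C, hC⟩ := exists_bound φ
  exact (integrable_norm_sq g).bdd_mul (c := C) (Lp.aestronglyMeasurable φ) hC

/-- Eigenvalues are real and bounded by the symbol. -/
theorem eigenvalue_real {q α C : ℝ} (hq : q ∈ Ioo (0 : ℝ) 1) (φ : Lp ℝ ∞ (boundaryMeasure q))
    (hC : ∀ᵐ z ∂boundaryMeasure q, |φ z| ≤ C) {g : hardySpace hq α} (hg : g ≠ 0) {c : ℂ}
    (h : toeplitz hq α φ g = c • (g : Lp ℂ 2 (boundaryMeasure q))) : ∃ l : ℝ, c = l ∧ |l| ≤ C := by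
  -- Testing against g itself gives c as the quotient of ∫ φ|g|² by ∫ |g|².
  have h1 := (toeplitz_eq_smul_iff hq φ g c).1 h g g.2
  obtain ⟨g, hgm⟩ := g
  have hg0 : g ≠ 0 := fun h0 => hg (Subtype.ext h0)
  simp only at h1
  set N := ∫ z, φ z * ‖g z‖ ^ 2 ∂boundaryMeasure q with hN
  set D := ∫ z, ‖g z‖ ^ 2 ∂boundaryMeasure q with hD
  have iN := integrable_mul_norm_sq φ g
  have iD := integrable_norm_sq g
  have hD0 : 0 < D := by
    refine lt_of_le_of_ne (integral_nonneg fun _ => by positivity) fun h0 => hg0 ?_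
    rw [Lp.eq_zero_iff_ae_eq_zero]
    have := (integral_eq_zero_iff_of_nonneg (fun _ => by positivity) iD).1 h0.symm
    filter_upwards [this] with z hz
    simpa using hz
  have iN' : Integrable (fun z => ((φ z * ‖g z‖ ^ 2 : ℝ) : ℂ)) (boundaryMeasure q) := iN.ofReal
  have iD' : Integrable (fun z => ((‖g z‖ ^ 2 : ℝ) : ℂ)) (boundaryMeasure q) := iD.ofReal
  have h2 : (N : ℂ) - c * D = 0 := by
    rw [← h1, hN, hD, ← integral_complex_ofReal, ← integral_complex_ofReal, ← integral_const_mul,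
      ← integral_sub iN' (iD'.const_mul c)]
    congr 1; funext z
    have := Complex.conj_mul' (g z)
    push_cast
    linear_combination -(φ z - c) * this
  have hDc : (D : ℂ) ≠ 0 := by exact_mod_cast hD0.ne'
  refine ⟨N / D, ?_, ?_⟩
  · push_cast
    rw [eq_div_iff hDc]; linear_combination -h2
  · rw [abs_div, abs_of_pos hD0, div_le_iff₀ hD0, hN, hD, ← integral_const_mul]
    refine (abs_integral_le_integral_abs).trans (integral_mono_ae iN.abs (iD.const_mul C) ?_)
    filter_upwards [hC] with z hz
    simp only [abs_mul, abs_pow, abs_norm]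
    gcongr

theorem coef_neg_of_real {f : ℝ → ℂ} (hf : ∀ t, (starRingEnd ℂ) (f t) = f t) (b : ℝ) :
    coef (-b) f = (starRingEnd ℂ) (coef b f) := by
  unfold coef
  rw [← integral_conj]
  congr 1; funext t
  rw [map_mul, hf, char_neg, char_neg]

theorem ae_eq_const_of_coef {f : ℝ → ℂ} (hf : Integrable f angle)
    (h : ∀ k : ℤ, k ≠ 0 → coef k f = 0) :
    ∀ᵐ t ∂angle, f t = coef 0 f / (2 * Real.pi) := by
  have hπ : (2 * Real.pi : ℂ) ≠ 0 := by exact_mod_cast Real.two_pi_pos.ne'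
  have h1 : ∀ k : ℤ, coef k (fun _ => coef 0 f / (2 * Real.pi)) =
      coef 0 f / (2 * Real.pi) * coef k (char 0) := fun k => by
    rw [← coef_const_mul]; congr 1; funext t; simp
  have h2 := ae_eq_zero_of_coef_int_eq_zero (f := fun t => f t - coef 0 f / (2 * Real.pi))
    (hf.sub (integrable_const _)) fun k => by
      rw [coef_sub hf (integrable_const _), h1]
      by_cases hk : k = 0
      · subst hk
        rw [Int.cast_zero, coef_char_self]; field_simp; ring
      · have h3 := coef_char_ne hk 0
        simp only [Int.cast_zero, add_zero] at h3
        rw [h k hk, h3]; ring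
  filter_upwards [h2] with t ht
  exact sub_eq_zero.1 ht

/-- For an eigenfunction `g` with eigenvalue `l`, the function `(φ - l)|g|²` is constant on each
boundary circle, and the two constants add up to `0`. -/
theorem exists_const_of_eigen {q α : ℝ} (hq : q ∈ Ioo (0 : ℝ) 1) (φ : Lp ℝ ∞ (boundaryMeasure q))
    {g : hardySpace hq α} {l : ℝ}
    (h : toeplitz hq α φ g = (l : ℂ) • (g : Lp ℂ 2 (boundaryMeasure q))) :
    ∃ d : ℝ, (∀ᵐ t ∂angle, (φ (circ 1 t) - l) *
        ‖(g : Lp ℂ 2 (boundaryMeasure q)) (circ 1 t)‖ ^ 2 = d) ∧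
      ∀ᵐ t ∂angle, (φ (circ q t) - l) *
        ‖(g : Lp ℂ 2 (boundaryMeasure q)) (circ q t)‖ ^ 2 = -d := by
  rw [toeplitz_eq_smul_iff] at h
  obtain ⟨g, hg⟩ := g
  simp only at h ⊢
  let ν : ℂ → ℂ := fun z => (((φ z - l) * ‖g z‖ ^ 2 : ℝ) : ℂ)
  have hν : MemLp ν 1 (boundaryMeasure q) := by
    have : Integrable (fun z => (φ z - l) * ‖g z‖ ^ 2) (boundaryMeasure q) := by
      simp only [sub_mul]
      exact (integrable_mul_norm_sq φ g).sub ((integrable_norm_sq g).const_mul l)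
    exact memLp_one_iff_integrable.2 this.ofReal
  have i1 := memLp_one_iff_integrable.1 (memLp_comp_one hν)
  have iq := memLp_one_iff_integrable.1 (memLp_comp_q hν)
  have hL := Real.log_neg hq.1 hq.2
  -- The test function is zⁿ g, which has the same index as g because n is an integer.
  have hrel : ∀ n : ℤ, coef n (ν ∘ circ 1) +
      (Real.exp (n * Real.log q) : ℝ) * coef n (ν ∘ circ q) = 0 := by
    intro n
    have hm : mulOp (memLp_cpow hq (n : ℝ)) g ∈ hardySpace hq α := by
      have := mulOp_cpow_mem hq hg (n : ℝ)
      rwa [hardySpace_add_int] at this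
    have h1 := h _ hm
    have e1 : (fun z => (starRingEnd ℂ) (mulOp (memLp_cpow hq (n : ℝ)) g z) * ((φ z - (l : ℂ)) * g z))
        =ᵐ[boundaryMeasure q] fun z => (starRingEnd ℂ) (z ^ ((n : ℝ) : ℂ)) * ν z := by
      filter_upwards [coeFn_mulOp (memLp_cpow hq (n : ℝ)) g] with z hz
      have := Complex.conj_mul' (g z)
      rw [hz, map_mul]
      simp only [ν]
      push_cast
      linear_combination (starRingEnd ℂ) (z ^ ((n : ℝ) : ℂ)) * (φ z - l) * this
    rw [integral_congr_ae e1, integral_boundary] at h1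
    · rw [← h1, ← coef_const_mul]
      congr 1
      · refine integral_congr_ae ?_
        filter_upwards [ae_angle_mem] with t ht
        rw [circ_cpow one_pos ht, char_neg]
        simp [mul_comm]
      · refine integral_congr_ae ?_
        filter_upwards [ae_angle_mem] with t ht
        rw [circ_cpow hq.1 ht, char_neg, map_mul, Complex.conj_ofReal, Function.comp_apply]
        ring
    · have hc : MemLp (fun z : ℂ => (starRingEnd ℂ) (z ^ ((n : ℝ) : ℂ))) ∞ (boundaryMeasure q) :=
        (memLp_cpow hq (n : ℝ)).star
      exact memLp_one_iff_integrable.1 (hν.mul hc)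
  have hreal : ∀ z, (starRingEnd ℂ) (ν z) = ν z := fun z => Complex.conj_ofReal _
  -- Write a, b for the n-th coefficients on B₁, B_q. The relation at n is a + qⁿ b = 0; the
  -- conjugate of the one at -n is a + q⁻ⁿ b = 0, as ν is real. Since qⁿ ≠ q⁻ⁿ for n ≠ 0, both
  -- vanish.
  have hzero : ∀ n : ℤ, n ≠ 0 → coef n (ν ∘ circ 1) = 0 ∧ coef n (ν ∘ circ q) = 0 := by
    intro n hn
    have h1 := hrel n
    have h2 := congrArg (starRingEnd ℂ) (hrel (-n))
    rw [map_add, map_mul, Complex.conj_ofReal, map_zero] at h2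
    push_cast at h1 h2
    rw [coef_neg_of_real (f := ν ∘ circ 1) (fun t => hreal _),
      coef_neg_of_real (f := ν ∘ circ q) (fun t => hreal _),
      Complex.conj_conj, Complex.conj_conj] at h2
    have h3 : ((Real.exp (n * Real.log q) - Real.exp (-n * Real.log q) : ℝ) : ℂ) *
        coef n (ν ∘ circ q) = 0 := by
      push_cast; linear_combination h1 - h2
    have h4 : Real.exp (n * Real.log q) - Real.exp (-n * Real.log q) ≠ 0 := by
      rw [sub_ne_zero, Ne, Real.exp_eq_exp, neg_mul, self_eq_neg, mul_eq_zero]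
      exact not_or.2 ⟨by exact_mod_cast hn, hL.ne⟩
    have h5 := (mul_eq_zero.1 h3).resolve_left (by exact_mod_cast h4)
    refine ⟨?_, h5⟩
    rw [h5, mul_zero, add_zero] at h1
    exact h1
  have c1 := ae_eq_const_of_coef i1 fun n hn => (hzero n hn).1
  have cq := ae_eq_const_of_coef iq fun n hn => (hzero n hn).2
  -- Frequency 0 is what makes the two constants opposite.
  have h0 := hrel 0
  simp only [Int.cast_zero, zero_mul, Real.exp_zero, Complex.ofReal_one, one_mul] at h0
  refine ⟨(coef 0 (ν ∘ circ 1) / (2 * Real.pi)).re, ?_, ?_⟩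
  · filter_upwards [c1] with t ht
    rw [← ht]; rfl
  · filter_upwards [cq] with t ht
    rw [eq_neg_of_add_eq_zero_left h0, neg_div, Complex.neg_re, neg_neg, ← ht]; rfl

/-- The data attached to a real eigenvalue. -/
theorem eigen_data {q : ℝ} (hq : q ∈ Ioo (0 : ℝ) 1) (φ : Lp ℝ ∞ (boundaryMeasure q)) {l : ℝ}
    (h : (l : ℂ) ∈ relativeEigenvalues hq φ) :
    ∃ (α : ℝ) (g : Lp ℂ 2 (boundaryMeasure q)) (d : ℝ), g ∈ hardySpace hq α ∧ g ≠ 0 ∧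
      (∀ᵐ t ∂angle, (φ (circ 1 t) - l) * ‖g (circ 1 t)‖ ^ 2 = d) ∧
      ∀ᵐ t ∂angle, (φ (circ q t) - l) * ‖g (circ q t)‖ ^ 2 = -d := by
  obtain ⟨α, -, g, hg0, hg⟩ := h
  obtain ⟨d, h1, h2⟩ := exists_const_of_eigen hq φ hg
  exact ⟨α, g, d, g.2, fun h => hg0 (Subtype.ext h), h1, h2⟩

/-! ### Order-connectedness of the eigenvalue set -/

theorem pos_of_mul_sq {x y d : ℝ} (h : x * y ^ 2 = d) (hd : 0 < d) : 0 < x := by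
  by_contra! hx
  nlinarith [mul_nonneg (neg_nonneg.2 hx) (sq_nonneg y)]

theorem neg_of_mul_sq {x y d : ℝ} (h : x * y ^ 2 = d) (hd : d < 0) : x < 0 := by
  have := pos_of_mul_sq (x := -x) (y := y) (d := -d) (by linarith) (by linarith)
  linarith

theorem ordConnected_step {q : ℝ} (hq : q ∈ Ioo (0 : ℝ) 1) (φ : Lp ℝ ∞ (boundaryMeasure q))
    {l₁ l₂ l : ℝ} (h₁ : (l₁ : ℂ) ∈ relativeEigenvalues hq φ)
    (h₂ : (l₂ : ℂ) ∈ relativeEigenvalues hq φ) (hl₁ : l₁ < l) (hl₂ : l < l₂) :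
    (l : ℂ) ∈ relativeEigenvalues hq φ := by
  obtain ⟨α, g, d, hg, hg0, g1, gq⟩ := eigen_data hq φ h₁
  obtain ⟨β, k, e, hk, hk0, k1, kq⟩ := eigen_data hq φ h₂
  have vanish1 : ∀ {γ : ℝ} {f : Lp ℂ 2 (boundaryMeasure q)}, f ∈ hardySpace hq γ → f ≠ 0 →
      ¬ ∀ᵐ t ∂angle, f (circ 1 t) = 0 := fun hf hf0 h =>
    hf0 (eq_zero_of_outer_eq_zero hq hf fun k => coef_eq_zero_of_ae h _)
  have vanishq : ∀ {γ : ℝ} {f : Lp ℂ 2 (boundaryMeasure q)}, f ∈ hardySpace hq γ → f ≠ 0 →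
      ¬ ∀ᵐ t ∂angle, f (circ q t) = 0 := fun hf hf0 h =>
    hf0 (eq_zero_of_inner_eq_zero hq hf fun k => coef_eq_zero_of_ae h _)
  have prod0 : ∀ {x r : ℝ} {y : ℂ}, (x - r) * ‖y‖ ^ 2 = 0 → x ≠ r → y = 0 := fun h hx => by
    simpa [sub_ne_zero.2 hx] using h
  rcases lt_trichotomy d 0 with hd | hd | hd <;> rcases lt_trichotomy e 0 with he | he | he
  -- Equal signs are the productive case: here φ < l₁ on B₁ and φ > l₂ on B_q, so the gap at l is at
  -- least the distance from l to {l₁, l₂}.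
  · refine mem_relativeEigenvalues_of_separated hq φ (δ := min (l - l₁) (l₂ - l)) (ε := -1)
      (lt_min (by linarith) (by linarith)) (by norm_num) ?_ ?_
    · filter_upwards [g1] with t ht
      have := neg_of_mul_sq ht hd
      linarith [min_le_left (l - l₁) (l₂ - l)]
    · filter_upwards [kq] with t ht
      have := pos_of_mul_sq ht (by linarith)
      linarith [min_le_right (l - l₁) (l₂ - l)]
  -- When exactly one constant is 0, the other fixes the side of φ on a circle; there φ misses the
  -- eigenvalue with constant 0, whose eigenfunction must vanish on that circle.
  · refine absurd ?_ (vanish1 hk hk0)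
    filter_upwards [g1, k1] with t ht ht'
    have := neg_of_mul_sq ht hd
    exact prod0 (by rw [ht', he]) (by linarith : φ (circ 1 t) < l₂).ne
  -- Opposite signs would put φ below l₁ and above l₂ on the same circle.
  · obtain ⟨t, ht, ht'⟩ := (g1.and k1).exists
    have := neg_of_mul_sq ht hd
    have := pos_of_mul_sq ht' he
    linarith
  · refine absurd ?_ (vanishq hg hg0)
    filter_upwards [gq, kq] with t ht ht'
    have := pos_of_mul_sq ht' (by linarith)
    exact prod0 (by rw [ht, hd, neg_zero]) (by linarith : l₁ < φ (circ q t)).ne'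
  -- With both constants 0, g lives where φ = l₁ and k where φ = l₂, so gk = 0 on B₁.
  · exfalso
    refine (eq_zero_or_eq_zero_of_mul_ae_eq_zero hq hg hk ?_).elim hg0 hk0
    filter_upwards [g1, k1] with t ht ht'
    by_cases hx : φ (circ 1 t) = l₁
    · rw [prod0 (ht'.trans he) (by rw [hx]; linarith), mul_zero]
    · rw [prod0 (ht.trans hd) hx, zero_mul]
  · refine absurd ?_ (vanish1 hg hg0)
    filter_upwards [g1, k1] with t ht ht'
    have := pos_of_mul_sq ht' he
    exact prod0 (ht.trans hd) (by linarith : l₁ < φ (circ 1 t)).ne'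
  · obtain ⟨t, ht, ht'⟩ := (gq.and kq).exists
    have := neg_of_mul_sq ht (by linarith)
    have := pos_of_mul_sq ht' (by linarith)
    linarith
  · refine absurd ?_ (vanishq hk hk0)
    filter_upwards [gq, kq] with t ht ht'
    have := neg_of_mul_sq ht (by linarith)
    exact prod0 (by rw [ht', he, neg_zero]) (by linarith : φ (circ q t) < l₂).ne
  · refine mem_relativeEigenvalues_of_separated hq φ (δ := min (l - l₁) (l₂ - l)) (ε := 1)
      (lt_min (by linarith) (by linarith)) (by norm_num) ?_ ?_
    · filter_upwards [k1] with t ht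
      have := pos_of_mul_sq ht he
      linarith [min_le_right (l - l₁) (l₂ - l)]
    · filter_upwards [gq] with t ht
      have := neg_of_mul_sq ht (by linarith)
      linarith [min_le_left (l - l₁) (l₂ - l)]

/-- Order-connected sets of reals are preconnected, hence intervals; boundedness rules out the rays
and the whole line. -/
theorem bounded_ordConnected_cases {S : Set ℝ} (ho : S.OrdConnected) {C : ℝ}
    (hC : ∀ x ∈ S, |x| ≤ C) :
    S = ∅ ∨ (∃ a : ℝ, S = {a}) ∨
      ∃ m M : ℝ, m < M ∧ (S = Ioo m M ∨ S = Ico m M ∨ S = Ioc m M ∨ S = Icc m M) := by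
  rcases S.subsingleton_or_nontrivial with hs | ⟨x, hx, y, hy, hxy⟩
  · rcases hs.eq_empty_or_singleton with h | h
    · exact Or.inl h
    · exact Or.inr (Or.inl h)
  refine Or.inr (Or.inr ⟨sInf S, sSup S, ?_, ?_⟩)
  · have hb : BddBelow S := ⟨-C, fun z hz => (abs_le.1 (hC z hz)).1⟩
    have ha : BddAbove S := ⟨C, fun z hz => (abs_le.1 (hC z hz)).2⟩
    rcases lt_or_gt_of_ne hxy with h | h
    · exact (csInf_le hb hx).trans_lt (h.trans_le (le_csSup ha hy))
    · exact (csInf_le hb hy).trans_lt (h.trans_le (le_csSup ha hx))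
  have hC' : S ⊆ Icc (-C) C := fun z hz => abs_le.1 (hC z hz)
  have h := ho.isPreconnected.mem_intervals
  simp only [mem_insert_iff, mem_singleton_iff] at h
  have hup : ∀ a, ¬ (Ioi a ⊆ Icc (-C) C) := fun a h => by
    have := h (show max a C + 1 ∈ Ioi a from by
      have := le_max_left a C; simp only [mem_Ioi]; linarith)
    linarith [this.2, le_max_right a C]
  have hdn : ∀ a, ¬ (Iio a ⊆ Icc (-C) C) := fun a h => by
    have := h (show min a (-C) - 1 ∈ Iio a from by
      have := min_le_left a (-C); simp only [mem_Iio]; linarith)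
    linarith [this.1, min_le_right a (-C)]
  rcases h with h | h | h | h | h | h | h | h | h | h
  · exact Or.inr (Or.inr (Or.inr h))
  · exact Or.inr (Or.inl h)
  · exact Or.inr (Or.inr (Or.inl h))
  · exact Or.inl h
  · exact absurd (Ioi_subset_Ici_self.trans (h ▸ hC')) (hup _)
  · exact absurd (h ▸ hC') (hup _)
  · exact absurd (Iio_subset_Iic_self.trans (h ▸ hC')) (hdn _)
  · exact absurd (h ▸ hC') (hdn _)
  · exact absurd ((subset_univ _).trans (h ▸ hC')) (hup 0)
  · rw [h] at hx; exact absurd hx (notMem_empty x)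

end AnnulusToeplitz

end

theorem corollary2p3 (q : ℝ) (hq : q ∈ Ioo (0 : ℝ) 1)
    (φ : Lp ℝ ∞ (AnnulusToeplitz.boundaryMeasure q)) :
    ∃ S : Set ℝ, AnnulusToeplitz.relativeEigenvalues hq φ = (fun x : ℝ => (x : ℂ)) '' S ∧
      (S = ∅ ∨ (∃ a : ℝ, S = {a}) ∨
        ∃ m M : ℝ, m < M ∧ (S = Ioo m M ∨ S = Ico m M ∨ S = Ioc m M ∨ S = Icc m M)) := by
  obtain ⟨C, hC⟩ := AnnulusToeplitz.exists_bound φ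
  have hreal : ∀ c ∈ AnnulusToeplitz.relativeEigenvalues hq φ, ∃ l : ℝ, c = l ∧ |l| ≤ C := by
    rintro c ⟨α, -, g, hg0, hg⟩
    exact AnnulusToeplitz.eigenvalue_real hq φ hC hg0 hg
  refine ⟨{l : ℝ | (l : ℂ) ∈ AnnulusToeplitz.relativeEigenvalues hq φ}, ?_,
    AnnulusToeplitz.bounded_ordConnected_cases (C := C) ⟨fun x hx y hy l hl => ?_⟩ fun l hl => ?_⟩
  · ext c
    refine ⟨fun hc => ?_, ?_⟩
    · obtain ⟨l, rfl, -⟩ := hreal c hc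
      exact ⟨l, hc, rfl⟩
    · rintro ⟨l, hl, rfl⟩
      exact hl
  · rcases eq_or_lt_of_le hl.1 with h | h
    · rwa [← h]
    rcases eq_or_lt_of_le hl.2 with h' | h'
    · rwa [h']
    exact AnnulusToeplitz.ordConnected_step hq φ hx hy h h'
  · obtain ⟨l', h, h'⟩ := hreal l hl
    rwa [Complex.ofReal_inj.1 h]
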